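/- **Setting.** Let $L/k$ be a cyclic extension of number fields of degree $n$ with $\mathrm{Gal}(L/k)=\langle\sigma\rangle$, where $L/\mathbb{Q}$ is Galois and $L$ is totally real or CM. Write $x\mapsto x^*$ for complex conjugation (on $L$ and on $k$), and write $a^{s}=s^{-1}(a)$ for an automorphism $s$. Let $\gamma\in\mathcal{O}_k$ with $\gamma\gamma^*=1$, and let $B=\bigoplus_{j=0}^{n-1}e^jL$ be the cyclic algebra with $e^n=\gamma$ and $ae=ea^{\sigma}$ for $a\in L$. Put $\Lambda=\bigoplus_{j=0}^{n-1}e^j\mathcal{O}_L$ and $\tau\bigl(\sum_j e^jx_j\bigr)=\sum_j x_j^*e^{-j}$. Let $\lambda\in L\cap\mathbb{R}$ be totally positive and set $$q_{B,\lambda}(x,y)=\mathrm{Tr}_{k/\mathbb{Q}}\bigl(\mathrm{Trd}_B(\lambda\tau(x)y)\bigr),\qquad \mathrm{Trd}_B\Bigl(\sum_j e^jx_j\Bigr)=\mathrm{Tr}_{L/k}(x_0).$$ Let $p$ be a prime number which is unramified or tamely ramified in $L$. Let $\mathfrak{p}$ be a prime ideal of $\mathcal{O}_k$ above $p$ with $\mathfrak{p}^*=\mathfrak{p}$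 which is inert in $L$, and put $\mathfrak{P}=\mathfrak{p}\mathcal{O}_L$, $\mathcal{P}=\Lambda\mathfrak{P}$ (a two-sided ideal of $\Lambda$). Assume that $q_{B,\lambda}$ is integral on $\Lambda$ and induces a well-defined and nondegenerate form $$\varphi:\Lambda/\mathcal{P}\times\Lambda/\mathcal{P}\to\mathbb{F}_p,\qquad([x],[y])\mapsto[q_{B,\lambda}(x,y)]_p .$$ For a left ideal $\mathcal{J}$ of $\Lambda/\mathcal{P}$ let $\mathcal{J}^\perp=\{y : \varphi(x,y)=0\text{ for all }x\in\mathcal{J}\}$; call $\mathcal{J}$ self-orthogonal if $\mathcal{J}\subseteq\mathcal{J}^\perp$ and self-dual if $\mathcal{J}=\mathcal{J}^\perp$. Let $\bar\sigma$ be the automorphism of $\mathcal{O}_L/\mathfrak{P}$ induced by $\sigma$, and let $(\mathcal{O}_L/\mathfrak{P})[X;\bar\sigma]$ be the skew polynomial ring with $aX=Xa^{\bar\sigma}$. Let $\rho:(\mathcal{O}_L/\mathfrak{P})[X;\bar\sigma]\to\Lambda/\mathcal{P}$ be the ring morphism with $X\mapsto[e]$ and $[a]_{\mathfrak{P}}\mapsto[a]_{\mathcal{P}}$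 for $a\in\mathcal{O}_L$. The left ideal corresponding to a monic divisor $\bar g$ of the central polynomial $X^n-[\gamma]_{\mathfrak{P}}$ is the left ideal generated by $\rho(\bar g)$. **Proposition.** Let $\bar g=\sum_{i=0}^dX^i[a_i]_{\mathfrak{P}}$ (with $a_i\in\mathcal{O}_L$) be a monic divisor, of degree $d$, of $X^n-[\gamma]_{\mathfrak{P}}$, and let $\mathcal{J}$ be the corresponding left ideal of $\Lambda/\mathcal{P}$. Then $v_{\mathfrak{P}}(\lambda)=0$, so that $\lambda=a/b$ with $a,b\in\mathcal{O}_L\setminus\mathfrak{P}$ has a residue class $[\lambda]_{\mathfrak{P}}=[a]_{\mathfrak{P}}[b]_{\mathfrak{P}}^{-1}$. Moreover $\mathcal{J}^\perp$ is the left ideal corresponding to the monic divisor $$\bar h=\frac{X^n-[\gamma]_{\mathfrak{P}}}{\bar g_{\bar\tau,\lambda}},\qquad\text{where}\qquad \bar g_{\bar\tau,\lambda}=\sum_{k=0}^dX^k\,[\lambda a_{d-k}^*]_{\mathfrak{P}}^{\bar\sigma^k}\,\bigl([\lambda a_0^*]_{\mathfrak{P}}^{-1}\bigr)^{\bar\sigma^d}.$$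 That is, $\bar h$ is monic of degree $n-d$ and $\bar h\,\bar g_{\bar\tau,\lambda}=\bar g_{\bar\tau,\lambda}\,\bar h=X^n-[\gamma]_{\mathfrak{P}}$. Furthermore, $\mathcal{J}$ is self-orthogonal if and only if $\bar g\,\bar g_{\bar\tau,\lambda}$ is a multiple of $X^n-[\gamma]_{\mathfrak{P}}$, and $\mathcal{J}$ is self-dual if and only if $\bar g\,\bar g_{\bar\tau,\lambda}=X^n-[\gamma]_{\mathfrak{P}}$. -/

import Mathlib

open NumberField

noncomputable section

namespace SkewCode

/-! ### Complex conjugation and totally positive elements -/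

/-- Complex conjugation on a field `F`: the automorphism of `F` that becomes complex conjugation
under every embedding `F → ℂ`. It exists for totally real and for CM fields
(`complexConj_spec`), and it is unique (the identity is a dummy value when it does not exist). -/
def complexConj (F : Type*) [Field F] : F ≃+* F :=
  open Classical in
  if h : ∃ c : F ≃+* F, ∀ (f : F →+* ℂ) (x : F), f (c x) = starRingEnd ℂ (f x) then h.choose
  else RingEquiv.refl F

theorem complexConj_spec (F : Type*) [Field F] [NumberField F]
    (hF : IsTotallyReal F ∨ IsCMField F) (f : F →+* ℂ) (x : F) :
    f (complexConj F x) = starRingEnd ℂ (f x) := by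
  have h : ∃ c : F ≃+* F, ∀ (f : F →+* ℂ) (x : F), f (c x) = starRingEnd ℂ (f x) := by
    rcases hF with hF | hF
    · refine ⟨RingEquiv.refl F, fun f x => ?_⟩
      have h1 : ComplexEmbedding.IsReal f := by
        have h2 := IsTotallyReal.isReal (K := F) (InfinitePlace.mk f)
        rwa [InfinitePlace.isReal_mk_iff] at h2
      have h3 := RingHom.congr_fun h1 x
      exact h3.symm
    · exact ⟨(IsCMField.complexConj F).toRingEquiv,
        fun f x => IsCMField.complexEmbedding_complexConj F f x⟩
  rw [complexConj, dif_pos h]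
  exact h.choose_spec f x

/-- Complex conjugation on the ring of integers. -/
def intConj (F : Type*) [Field F] : 𝓞 F ≃+* 𝓞 F :=
  RingOfIntegers.mapRingEquiv (complexConj F)

/-- `x` is totally positive: its image under every complex embedding is real and positive. -/
def IsTotallyPositive {F : Type*} [Field F] (x : F) : Prop :=
  ∀ f : F →+* ℂ, (f x).im = 0 ∧ 0 < (f x).re

/-! ### Skew polynomials -/

section SkewPolynomials

variable {F : Type*} [CommRing F]

/-- The exponent notation `a ^ (s ^ k) = s⁻ᵏ(a)` for an automorphism `s`. -/
def twist (s : F ≃+* F) (k : ℕ) : F ≃+* F := (s⁻¹ : RingAut F) ^ k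

/-- The ring `F`, as the coefficient ring of the skew polynomial ring for the automorphism `s`. -/
def SkewCoeff (_ : F ≃+* F) : Type _ := F

instance (s : F ≃+* F) : CommRing (SkewCoeff s) := inferInstanceAs (CommRing F)

/-- The identity map from `F` to the coefficient ring. -/
def toCoeff (s : F ≃+* F) : F ≃+* SkewCoeff s := RingEquiv.refl F

/-- `Multiplicative ℕ` acts on the coefficients through the powers of `s`. -/
instance (s : F ≃+* F) : MulSemiringAction (Multiplicative ℕ) (SkewCoeff s) where
  smul m a := toCoeff s (((s : RingAut F) ^ m.toAdd) ((toCoeff s).symm a))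
  one_smul _ := rfl
  mul_smul m m' a := by
    change toCoeff s (((s : RingAut F) ^ (m.toAdd + m'.toAdd)) _) = _
    rw [pow_add]; rfl
  smul_zero m := by change toCoeff s (((s : RingAut F) ^ m.toAdd) _) = _; simp
  smul_add m a b := map_add ((s : RingAut F) ^ m.toAdd) a b
  smul_one m := by change toCoeff s (((s : RingAut F) ^ m.toAdd) _) = _; simp
  smul_mul m a b := map_mul ((s : RingAut F) ^ m.toAdd) a b

/-- The skew polynomial ring `F[X; s]`, with `X * a = s(a) * X`, that is `a * X = X * a ^ s`. -/
abbrev SkewPoly (s : F ≃+* F) : Type _ := SkewPolynomial (SkewCoeff s)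

/-- The constant skew polynomial `a`. -/
def const (s : F ≃+* F) (a : F) : SkewPoly s := SkewPolynomial.C (toCoeff s a)

/-- The variable `X`. -/
def var (s : F ≃+* F) : SkewPoly s := SkewPolynomial.X

theorem const_mul_var (s : F ≃+* F) (a : F) :
    const s a * var s = var s * const s (twist s 1 a) := by
  unfold const var
  rw [← SkewPolynomial.monomial_one_one_eq_X, SkewPolynomial.C_mul_monomial,
    SkewPolynomial.monomial_mul_C, mul_one, one_mul]
  congr 1
  change a = s ((s⁻¹ : RingAut F) ^ 1 <| a)
  rw [pow_one]
  exact (RingEquiv.apply_symm_apply s a).symm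

/-- The skew polynomial `∑_{i ≤ d} Xⁱ bᵢ`, with the coefficients on the right. -/
def ofCoeffs (s : F ≃+* F) (d : ℕ) (b : ℕ → F) : SkewPoly s :=
  ∑ i ∈ Finset.range (d + 1), var s ^ i * const s (b i)

/-- `f` is monic of degree `d`. -/
def IsMonicOfDegree {s : F ≃+* F} (f : SkewPoly s) (d : ℕ) : Prop :=
  ∃ b : ℕ → F, b d = 1 ∧ f = ofCoeffs s d b

end SkewPolynomials

/-! ### The cyclic algebra -/

section Cyclic

set_option linter.unusedSectionVars false

variable {k L : Type*} [Field k] [Field L] [Algebra k L]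

/-- The cyclic algebra `(γ, L/k, σ) = ⨁_{j < n} eʲ L` with `n = [L : k]`, `eⁿ = γ` and
`a e = e a ^ σ`. The element `∑ eʲ xⱼ` is represented by its coordinates `j ↦ xⱼ`. -/
def CyclicAlgebra (_ : L ≃ₐ[k] L) (_ : k) : Type _ := Fin (Module.finrank k L) → L

namespace CyclicAlgebra

variable (σ : L ≃ₐ[k] L) (γ : k)

instance : AddCommGroup (CyclicAlgebra σ γ) :=
  inferInstanceAs (AddCommGroup (Fin (Module.finrank k L) → L))

variable {σ γ} in
/-- The coordinate `xⱼ` of `x = ∑ eʲ xⱼ`. -/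
def coord (j : Fin (Module.finrank k L)) : CyclicAlgebra σ γ →+ L := Pi.evalAddMonoidHom _ j

variable {σ γ} in
@[ext] theorem ext {x y : CyclicAlgebra σ γ} (h : ∀ j, coord j x = coord j y) : x = y := funext h

variable [FiniteDimensional k L]

instance : NeZero (Module.finrank k L) := ⟨Module.finrank_pos.ne'⟩

/-- The element `eᵐ a` for any `m`, in coordinates: it is `e^(m mod n) γ^(m div n) a`. -/
def mono (m : ℕ) : L →+ CyclicAlgebra σ γ :=
  (AddMonoidHom.single (fun _ : Fin (Module.finrank k L) => L) (Fin.ofNat _ m)).comp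
    (AddMonoidHom.mulLeft (algebraMap k L γ ^ (m / Module.finrank k L)))

theorem coord_mono (m : ℕ) (a : L) (j : Fin (Module.finrank k L)) :
    coord j (mono σ γ m a) = if m % Module.finrank k L = j
      then algebraMap k L γ ^ (m / Module.finrank k L) * a else 0 := by
  change Pi.single (M := fun _ => L) (Fin.ofNat _ m) _ j = _
  rw [Pi.single_apply]
  congr 1
  rw [Fin.ext_iff, eq_iff_iff]
  exact eq_comm

theorem mono_add_mul (m l : ℕ) (a : L) :
    mono σ γ (m + Module.finrank k L * l) a = mono σ γ m (algebraMap k L γ ^ l * a) := by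
  ext j
  rw [coord_mono, coord_mono, Nat.add_mul_mod_self_left,
    Nat.add_mul_div_left _ _ Module.finrank_pos, pow_add, mul_assoc]

theorem sum_mono (x : CyclicAlgebra σ γ) : ∑ j : Fin (Module.finrank k L), mono σ γ j (coord j x) = x := by
  ext i
  rw [map_sum]
  simp only [coord_mono]
  rw [Finset.sum_eq_single i]
  · simp [Nat.mod_eq_of_lt i.2, Nat.div_eq_of_lt i.2]
  · intro j _ hj
    rw [if_neg]
    rw [Nat.mod_eq_of_lt j.2]
    exact fun h => hj (Fin.ext h)
  · simp

/-- The product, determined by `(eⁱ a) (eʲ b) = e^(i+j) a^(σ^j) b`. -/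
instance : Mul (CyclicAlgebra σ γ) :=
  ⟨fun x y => ∑ i : Fin (Module.finrank k L), ∑ j : Fin (Module.finrank k L), mono σ γ (i + j)
    (twist σ.toRingEquiv j (coord i x) * coord j y)⟩

instance : One (CyclicAlgebra σ γ) := ⟨mono σ γ 0 1⟩

theorem mul_def (x y : CyclicAlgebra σ γ) : x * y = ∑ i : Fin (Module.finrank k L), ∑ j : Fin (Module.finrank k L), mono σ γ (i + j)
    (twist σ.toRingEquiv j (coord i x) * coord j y) := rfl

theorem one_def : (1 : CyclicAlgebra σ γ) = mono σ γ 0 1 := rfl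

theorem twist_add (s : L ≃+* L) (i j : ℕ) (a : L) :
    twist s (i + j) a = twist s i (twist s j a) := by
  unfold twist; rw [pow_add]; rfl

theorem twist_algebraMap (j : ℕ) (c : k) :
    twist σ.toRingEquiv j (algebraMap k L c) = algebraMap k L c := by
  induction j with
  | zero => rfl
  | succ j ih =>
    rw [twist_add, show twist σ.toRingEquiv 1 (algebraMap k L c) = algebraMap k L c from ?_, ih]
    change σ.symm (algebraMap k L c) = _
    exact σ.symm.commutes c

theorem pow_twist (j : ℕ) (a : L) : (σ ^ j) (twist σ.toRingEquiv j a) = a := by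
  induction j with
  | zero => rfl
  | succ j ih =>
    rw [add_comm, twist_add, add_comm, pow_succ, AlgEquiv.mul_apply]
    change (σ ^ j) (σ (σ.symm _)) = a
    rw [AlgEquiv.apply_symm_apply, ih]

variable [IsGalois k L]

theorem twist_finrank_mul (l : ℕ) (a : L) :
    twist σ.toRingEquiv (Module.finrank k L * l) a = a := by
  have h : σ ^ (Module.finrank k L * l) = 1 := by
    rw [pow_mul, ← IsGalois.card_aut_eq_finrank, pow_card_eq_one', one_pow]
  have h2 := pow_twist σ (Module.finrank k L * l) a
  rwa [h] at h2

theorem twist_mod (j : ℕ) (a : L) :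
    twist σ.toRingEquiv (j % Module.finrank k L) a = twist σ.toRingEquiv j a := by
  conv_rhs => rw [← Nat.mod_add_div j (Module.finrank k L), twist_add, twist_finrank_mul]

theorem mono_mul_mono (m l : ℕ) (a b : L) :
    mono σ γ m a * mono σ γ l b = mono σ γ (m + l) (twist σ.toRingEquiv l a * b) := by
  have hn : 0 < Module.finrank k L := Module.finrank_pos
  rw [mul_def, Finset.sum_eq_single ⟨m % Module.finrank k L, Nat.mod_lt _ hn⟩,
    Finset.sum_eq_single ⟨l % Module.finrank k L, Nat.mod_lt _ hn⟩]
  · simp only [coord_mono, if_true, twist_mod, map_mul, map_pow, twist_algebraMap]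
    have h1 : m + l = (m % Module.finrank k L + l % Module.finrank k L) +
        Module.finrank k L * (m / Module.finrank k L + l / Module.finrank k L) := by
      conv_lhs => rw [← Nat.mod_add_div m (Module.finrank k L),
        ← Nat.mod_add_div l (Module.finrank k L)]
      ring
    conv_rhs => rw [h1, mono_add_mul]
    congr 1
    ring
  · intro j _ hj
    rw [coord_mono (m := l), if_neg, mul_zero, map_zero]
    exact fun h => hj (Fin.ext h.symm)
  · simp
  · intro i _ hi
    refine Finset.sum_eq_zero fun j _ => ?_
    rw [coord_mono (m := m), if_neg, map_zero, zero_mul, map_zero]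
    exact fun h => hi (Fin.ext h.symm)
  · simp

theorem add_mul' (x y z : CyclicAlgebra σ γ) : (x + y) * z = x * z + y * z := by
  simp only [mul_def, map_add, add_mul, Finset.sum_add_distrib]

theorem mul_add' (x y z : CyclicAlgebra σ γ) : x * (y + z) = x * y + x * z := by
  simp only [mul_def, map_add, mul_add, Finset.sum_add_distrib]

variable {σ γ} in
theorem induction {P : CyclicAlgebra σ γ → Prop} (hm : ∀ m a, P (mono σ γ m a))
    (ha : ∀ x y, P x → P y → P (x + y)) (x : CyclicAlgebra σ γ) : P x := by
  rw [← sum_mono σ γ x]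
  exact Finset.sum_induction _ P ha (by rw [← map_zero (mono σ γ 0)]; exact hm 0 0)
    fun j _ => hm _ _

instance : Ring (CyclicAlgebra σ γ) where
  __ := (inferInstance : AddCommGroup (CyclicAlgebra σ γ))
  left_distrib := mul_add' σ γ
  right_distrib := add_mul' σ γ
  zero_mul x := by simp [mul_def]
  mul_zero x := by simp [mul_def]
  mul_assoc x y z := by
    induction x using induction with
    | ha x x' h h' => simp only [add_mul', h, h']
    | hm m a =>
    induction y using induction with
    | ha y y' h h' => simp only [add_mul', mul_add', h, h']
    | hm l b =>
    induction z using induction with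
    | ha z z' h h' => simp only [mul_add', h, h']
    | hm r c =>
    simp only [mono_mul_mono, map_mul]
    rw [add_comm l r, twist_add, add_comm r l, add_assoc, mul_assoc]
  one_mul x := by
    induction x using induction with
    | ha x x' h h' => simp only [mul_add', h, h']
    | hm m a => rw [one_def, mono_mul_mono, map_one, one_mul, zero_add]
  mul_one x := by
    induction x using induction with
    | ha x x' h h' => simp only [add_mul', h, h']
    | hm m a => rw [one_def, mono_mul_mono, mul_one, add_zero]; rfl

/-- The inclusion of `L` as the subring `e⁰ L`. -/
def incl : L →+* CyclicAlgebra σ γ where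
  toFun := mono σ γ 0
  map_one' := rfl
  map_mul' a b := by rw [mono_mul_mono]; rfl
  map_zero' := map_zero _
  map_add' := map_add _

/-- The generator `e`. -/
def e : CyclicAlgebra σ γ := mono σ γ 1 1

/-- The inverse `e⁻¹ = eⁿ⁻¹ γ⁻¹` of `e` (see `e_mul_eInv`). -/
def eInv : CyclicAlgebra σ γ := e σ γ ^ (Module.finrank k L - 1) * incl σ γ (algebraMap k L γ⁻¹)

theorem e_pow (m : ℕ) : e σ γ ^ m = mono σ γ m 1 := by
  induction m with
  | zero => rfl
  | succ m ih => rw [pow_succ, ih, e, mono_mul_mono, map_one, mul_one]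

theorem e_pow_mul_incl (m : ℕ) (a : L) : e σ γ ^ m * incl σ γ a = mono σ γ m a := by
  rw [e_pow]
  change mono σ γ m 1 * mono σ γ 0 a = _
  rw [mono_mul_mono, map_one, one_mul, add_zero]

theorem e_pow_finrank : e σ γ ^ Module.finrank k L = incl σ γ (algebraMap k L γ) := by
  have h := mono_add_mul σ γ 0 1 1
  rw [zero_add, mul_one, pow_one, mul_one] at h
  rw [e_pow, h]; rfl

theorem incl_mul_e (a : L) :
    incl σ γ a * e σ γ = e σ γ * incl σ γ (twist σ.toRingEquiv 1 a) := by
  have h := e_pow_mul_incl σ γ 1 (twist σ.toRingEquiv 1 a)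
  rw [pow_one] at h
  rw [h]
  change mono σ γ 0 a * mono σ γ 1 1 = _
  rw [mono_mul_mono, mul_one, zero_add]

theorem e_mul_eInv (hγ : γ ≠ 0) : e σ γ * eInv σ γ = 1 := by
  rw [eInv, ← mul_assoc, ← pow_succ', Nat.sub_add_cancel Module.finrank_pos, e_pow_finrank,
    ← map_mul, ← map_mul, mul_inv_cancel₀ hγ, map_one, map_one]

theorem eq_sum (x : CyclicAlgebra σ γ) :
    x = ∑ j : Fin (Module.finrank k L), e σ γ ^ (j : ℕ) * incl σ γ (coord j x) := by
  simp only [e_pow_mul_incl]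
  exact (sum_mono σ γ x).symm

/-- The map `τ (∑ eʲ xⱼ) = ∑ xⱼ* e⁻ʲ`, where `*` is complex conjugation. -/
def tau : CyclicAlgebra σ γ →+ CyclicAlgebra σ γ :=
  ∑ j : Fin (Module.finrank k L), (AddMonoidHom.mulRight (eInv σ γ ^ (j : ℕ))).comp
    ((incl σ γ).toAddMonoidHom.comp ((complexConj L).toAddEquiv.toAddMonoidHom.comp (coord j)))

theorem tau_apply (x : CyclicAlgebra σ γ) : tau σ γ x =
    ∑ j : Fin (Module.finrank k L),
      incl σ γ (complexConj L (coord j x)) * eInv σ γ ^ (j : ℕ) := by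
  simp [tau]

/-- The reduced trace `Trd_B (∑ eʲ xⱼ) = Tr_{L/k} (x₀)`. -/
def reducedTrace : CyclicAlgebra σ γ →+ k :=
  (Algebra.trace k L).toAddMonoidHom.comp (coord 0)

/-- `reducedTrace` is the reduced trace: `B ⊗ L` is split by the action of `B` by left
multiplication on the right `L`-vector space `B`, and `reducedTrace x` is the trace of the matrix
of left multiplication by `x` in the basis `1, e, …, eⁿ⁻¹` of this vector space. -/
theorem algebraMap_reducedTrace (hσ : ∀ s : L ≃ₐ[k] L, s ∈ Subgroup.zpowers σ)
    (x : CyclicAlgebra σ γ) :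
    algebraMap k L (reducedTrace σ γ x) =
      ∑ j : Fin (Module.finrank k L), coord j (x * e σ γ ^ (j : ℕ)) := by
  have h1 : ∀ j : Fin (Module.finrank k L), coord j (x * e σ γ ^ (j : ℕ)) =
      twist σ.toRingEquiv j (coord 0 x) := by
    intro j
    conv_lhs => rw [← sum_mono σ γ x]
    rw [Finset.sum_mul, map_sum, Finset.sum_eq_single 0]
    · rw [e_pow, mono_mul_mono, coord_mono]
      simp [Nat.mod_eq_of_lt j.2, Nat.div_eq_of_lt j.2]
    · intro i _ hi
      rw [e_pow, mono_mul_mono, coord_mono, if_neg]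
      intro h
      apply hi
      have h2 : ((i : ℕ) + j) ≡ 0 + j [MOD Module.finrank k L] := by
        rw [Nat.ModEq, h, zero_add, Nat.mod_eq_of_lt j.2]
      have h3 := Nat.ModEq.add_right_cancel' _ h2
      rw [Nat.ModEq, Nat.mod_eq_of_lt i.2, Nat.zero_mod] at h3
      exact Fin.ext h3
    · simp
  have h2 : ∀ (j : ℕ) (a : L), twist σ.toRingEquiv j a = (σ ^ j)⁻¹ a := by
    intro j a
    conv_rhs => rw [← pow_twist σ j a]
    exact ((AlgEquiv.symm_apply_apply (σ ^ j) _)).symm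
  simp only [h1, h2]
  change algebraMap k L (Algebra.trace k L (coord 0 x)) = _
  rw [trace_eq_sum_automorphisms]
  have hord : orderOf σ = Module.finrank k L := by
    rw [← IsGalois.card_aut_eq_finrank k L]
    exact orderOf_eq_card_of_forall_mem_zpowers hσ
  symm
  refine Fintype.sum_bijective (fun j : Fin (Module.finrank k L) => (σ ^ (j : ℕ))⁻¹) ?_ _ _
    fun _ => rfl
  rw [Fintype.bijective_iff_injective_and_card]
  refine ⟨fun i j hij => Fin.ext ?_, ?_⟩
  · exact pow_injOn_Iio_orderOf (by rw [hord]; exact i.2) (by rw [hord]; exact j.2)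
      (inv_injective hij)
  · rw [Fintype.card_fin, ← IsGalois.card_aut_eq_finrank k L, Nat.card_eq_fintype_card]

end CyclicAlgebra

end Cyclic

set_option linter.unusedSectionVars false

/-! ### The order `Λ`, its quotient `Λ/𝒫`, and the form on it -/

section Order

variable {k L : Type*} [Field k] [Field L] [Algebra k L] [FiniteDimensional k L] [IsGalois k L]

open CyclicAlgebra

/-- The subring `Λ = ⨁ eʲ 𝓞_L` of `B = (γ, L/k, σ)`, for `γ ∈ 𝓞_k`. -/
def order (σ : L ≃ₐ[k] L) (γ : 𝓞 k) : Subring (CyclicAlgebra σ (γ : k)) where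
  carrier := {x | ∀ j, IsIntegral ℤ (coord j x)}
  zero_mem' j := by rw [map_zero]; exact isIntegral_zero
  add_mem' hx hy j := by rw [map_add]; exact (hx j).add (hy j)
  neg_mem' hx j := by rw [map_neg]; exact (hx j).neg
  one_mem' j := by
    rw [one_def, coord_mono]
    split_ifs
    · simpa using isIntegral_one
    · exact isIntegral_zero
  mul_mem' {x y} hx hy j := by
    rw [mul_def, map_sum]
    refine IsIntegral.sum _ fun i _ => ?_
    rw [map_sum]
    refine IsIntegral.sum _ fun l _ => ?_
    rw [coord_mono]
    split_ifs
    · refine IsIntegral.mul (IsIntegral.pow ?_ _) (IsIntegral.mul ?_ (hy l))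
      · exact (RingOfIntegers.isIntegral_coe γ).algebraMap
      · exact (hx i).map (twist σ.toRingEquiv l).toRingHom.toIntAlgHom
    · exact isIntegral_zero

variable (σ : L ≃ₐ[k] L) (γ : 𝓞 k)

/-- The inclusion `𝓞_L ⊆ Λ`. -/
def orderIncl : 𝓞 L →+* order σ γ :=
  ((incl σ (γ : k)).comp (algebraMap (𝓞 L) L)).codRestrict (order σ γ) fun a j => by
    change IsIntegral ℤ (coord j (mono σ _ 0 (a : L)))
    rw [coord_mono]
    split_ifs
    · simpa using RingOfIntegers.isIntegral_coe a
    · exact isIntegral_zero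

/-- The element `e` of `Λ`. -/
def orderE : order σ γ := ⟨e σ (γ : k), fun j => by
  rw [e, coord_mono]
  split_ifs
  · refine IsIntegral.mul (IsIntegral.pow ?_ _) isIntegral_one
    exact (RingOfIntegers.isIntegral_coe γ).algebraMap
  · exact isIntegral_zero⟩

/-- The automorphism of `𝓞_L` induced by `σ`. -/
def intAut : 𝓞 L ≃+* 𝓞 L := RingOfIntegers.mapRingEquiv σ.toRingEquiv

theorem orderIncl_mul_orderE (a : 𝓞 L) :
    orderIncl σ γ a * orderE σ γ = orderE σ γ * orderIncl σ γ ((intAut σ).symm a) :=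
  Subtype.ext (incl_mul_e σ (γ : k) a)

variable (L) in
/-- The ideal `𝔓 = 𝔭 𝓞_L`. -/
abbrev extIdeal (𝔭 : Ideal (𝓞 k)) : Ideal (𝓞 L) := 𝔭.map (algebraMap (𝓞 k) (𝓞 L))

variable (L) in
/-- The residue ring `𝓞_L / 𝔓` for `𝔓 = 𝔭 𝓞_L`. -/
abbrev ResidueRing (𝔭 : Ideal (𝓞 k)) : Type _ := 𝓞 L ⧸ extIdeal L 𝔭

variable (𝔭 : Ideal (𝓞 k))

theorem map_intAut_extIdeal : extIdeal L 𝔭 = (extIdeal L 𝔭).map (intAut σ : 𝓞 L →+* 𝓞 L) := by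
  rw [Ideal.map_map]
  refine congrArg (fun f => Ideal.map f 𝔭) (RingHom.ext fun x => RingOfIntegers.ext ?_)
  exact (σ.commutes (x : k)).symm

/-- The automorphism `σ̄` of `𝓞_L / 𝔓` induced by `σ`. -/
def resAut : ResidueRing L 𝔭 ≃+* ResidueRing L 𝔭 :=
  Ideal.quotientEquiv _ _ (intAut σ) (map_intAut_extIdeal σ 𝔭)

/-- The ideal `𝒫 = Λ 𝔓` of `Λ`, that is the left ideal generated by `𝔓 = 𝔭 𝓞_L`. -/
def bigIdeal : Ideal (order σ γ) := (extIdeal L 𝔭).map (orderIncl σ γ)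

theorem orderIncl_algebraMap_mul (c : 𝓞 k) (x : order σ γ) :
    orderIncl σ γ (algebraMap (𝓞 k) (𝓞 L) c) * x =
      x * orderIncl σ γ (algebraMap (𝓞 k) (𝓞 L) c) := by
  apply Subtype.ext
  change mono σ (γ : k) 0 (algebraMap k L c) * x.1 = x.1 * mono σ (γ : k) 0 (algebraMap k L c)
  induction x.1 using CyclicAlgebra.induction with
  | ha x y hx hy => rw [mul_add, add_mul, hx, hy]
  | hm m a =>
    rw [mono_mul_mono, mono_mul_mono, twist_algebraMap, zero_add, add_zero, mul_comm]
    rfl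

instance : (bigIdeal σ γ 𝔭).IsTwoSided where
  mul_mem_of_left {x} y hx := by
    unfold bigIdeal at hx ⊢
    induction hx using Submodule.span_induction with
    | zero => rw [zero_mul]; exact Ideal.zero_mem _
    | add x x' _ _ h h' => rw [add_mul]; exact Ideal.add_mem _ h h'
    | smul r x _ h => rw [smul_eq_mul, mul_assoc]; exact Ideal.mul_mem_left _ r h
    | mem x hx =>
      obtain ⟨a, ha, rfl⟩ := hx
      induction ha using Submodule.span_induction with
      | zero => rw [map_zero, zero_mul]; exact Ideal.zero_mem _
      | add a a' _ _ h h' => rw [map_add, add_mul]; exact Ideal.add_mem _ h h'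
      | smul r a _ h =>
        rw [smul_eq_mul, map_mul, mul_assoc]; exact Ideal.mul_mem_left _ _ h
      | mem a ha =>
        obtain ⟨c, hc, rfl⟩ := ha
        rw [orderIncl_algebraMap_mul]
        exact Ideal.mul_mem_left _ _ (Ideal.mem_map_of_mem _ (Ideal.mem_map_of_mem _ hc))

/-- The quotient ring `Λ/𝒫`. -/
abbrev CodeRing : Type _ := order σ γ ⧸ bigIdeal σ γ 𝔭

/-- The map `𝓞_L / 𝔓 → Λ/𝒫` induced by the inclusion `𝓞_L ⊆ Λ`. -/
def resIncl : ResidueRing L 𝔭 →+* CodeRing σ γ 𝔭 :=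
  Ideal.Quotient.lift _ ((Ideal.Quotient.mk (bigIdeal σ γ 𝔭)).comp (orderIncl σ γ)) fun _ ha =>
    Ideal.Quotient.eq_zero_iff_mem.2 (Ideal.mem_map_of_mem _ ha)

theorem resIncl_mul_e (c : ResidueRing L 𝔭) :
    resIncl σ γ 𝔭 (resAut σ 𝔭 c) * Ideal.Quotient.mk (bigIdeal σ γ 𝔭) (orderE σ γ) =
      Ideal.Quotient.mk (bigIdeal σ γ 𝔭) (orderE σ γ) * resIncl σ γ 𝔭 c := by
  obtain ⟨a, rfl⟩ := Ideal.Quotient.mk_surjective c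
  change Ideal.Quotient.mk (bigIdeal σ γ 𝔭) (orderIncl σ γ (intAut σ a)) * _ =
    _ * Ideal.Quotient.mk (bigIdeal σ γ 𝔭) (orderIncl σ γ a)
  rw [← map_mul, ← map_mul, orderIncl_mul_orderE, RingEquiv.symm_apply_apply]

theorem resIncl_mul_e_pow (j : ℕ) (c : ResidueRing L 𝔭) :
    resIncl σ γ 𝔭 (((resAut σ 𝔭 : RingAut _) ^ j) c) *
        (Ideal.Quotient.mk (bigIdeal σ γ 𝔭) (orderE σ γ)) ^ j =
      (Ideal.Quotient.mk (bigIdeal σ γ 𝔭) (orderE σ γ)) ^ j * resIncl σ γ 𝔭 c := by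
  induction j generalizing c with
  | zero => rw [pow_zero, pow_zero, mul_one, one_mul]; rfl
  | succ j ih =>
    have h : ((resAut σ 𝔭 : RingAut _) ^ (j + 1)) c =
        ((resAut σ 𝔭 : RingAut _) ^ j) (resAut σ 𝔭 c) := by rw [pow_succ]; rfl
    rw [h, pow_succ, ← mul_assoc, ih, mul_assoc, resIncl_mul_e, mul_assoc]

/-- The ring morphism `ρ : (𝓞_L / 𝔓)[X; σ̄] → Λ/𝒫` sending `X` to the class of `e` and the class of
`a ∈ 𝓞_L` modulo `𝔓` to its class modulo `𝒫`. -/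
def rho : SkewPoly (resAut σ 𝔭) →+* CodeRing σ γ 𝔭 :=
  SkewMonoidAlgebra.liftNCRingHom
    ((resIncl σ γ 𝔭).comp (toCoeff (resAut σ 𝔭)).symm.toRingHom)
    (powersHom _ (Ideal.Quotient.mk (bigIdeal σ γ 𝔭) (orderE σ γ)))
    fun {c j} => resIncl_mul_e_pow σ γ 𝔭 j.toAdd ((toCoeff (resAut σ 𝔭)).symm c)

theorem rho_const (a : 𝓞 L) : rho σ γ 𝔭 (const (resAut σ 𝔭) (Ideal.Quotient.mk _ a)) =
    Ideal.Quotient.mk (bigIdeal σ γ 𝔭) (orderIncl σ γ a) := by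
  have h := SkewMonoidAlgebra.liftNC_single
    (((resIncl σ γ 𝔭).comp (toCoeff (resAut σ 𝔭)).symm.toRingHom : _ →+* _) : _ →+ _)
    (powersHom _ (Ideal.Quotient.mk (bigIdeal σ γ 𝔭) (orderE σ γ))) 1
    (toCoeff (resAut σ 𝔭) (Ideal.Quotient.mk _ a))
  rw [map_one, mul_one] at h
  exact h

theorem rho_var : rho σ γ 𝔭 (var (resAut σ 𝔭)) =
    Ideal.Quotient.mk (bigIdeal σ γ 𝔭) (orderE σ γ) := by
  have h := SkewMonoidAlgebra.liftNC_single
    (((resIncl σ γ 𝔭).comp (toCoeff (resAut σ 𝔭)).symm.toRingHom : _ →+* _) : _ →+ _)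
    (powersHom _ (Ideal.Quotient.mk (bigIdeal σ γ 𝔭) (orderE σ γ))) (Multiplicative.ofAdd 1)
    (toCoeff (resAut σ 𝔭) 1)
  refine h.trans ?_
  change resIncl σ γ 𝔭 1 * Ideal.Quotient.mk (bigIdeal σ γ 𝔭) (orderE σ γ) ^ 1 = _
  rw [map_one, one_mul, pow_one]

/-- The left ideal of `Λ/𝒫` that corresponds to the skew polynomial `g`: it is generated by `ρ(g)`,
that is by the class of `g(e)`. -/
def codeIdeal (g : SkewPoly (resAut σ 𝔭)) : Ideal (CodeRing σ γ 𝔭) := Ideal.span {rho σ γ 𝔭 g}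

/-- The form `q_{B,λ}(x, y) = Tr_{k/ℚ} (Trd_B (λ τ(x) y))` on the cyclic algebra `B`. -/
def form [NumberField k] (lam : L) :
    CyclicAlgebra σ (γ : k) →+ CyclicAlgebra σ (γ : k) →+ ℚ :=
  AddMonoidHom.mk' (fun x => (Algebra.trace ℚ k).toAddMonoidHom.comp
    ((reducedTrace σ (γ : k)).comp (AddMonoidHom.mulLeft (incl σ (γ : k) lam * tau σ (γ : k) x))))
    fun x x' => by ext y; simp [mul_add, add_mul]

theorem form_apply [NumberField k] (lam : L) (x y : CyclicAlgebra σ (γ : k)) :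
    form σ γ lam x y = Algebra.trace ℚ k
      (reducedTrace σ (γ : k) (incl σ (γ : k) lam * tau σ (γ : k) x * y)) := rfl

/-- The form `q_{B,λ}` induces a well-defined form `Λ/𝒫 × Λ/𝒫 → 𝔽_p`: it takes integral values on
`Λ`, and its value modulo `p` depends only on the classes modulo `𝒫`. -/
def FormDescends [NumberField k] (lam : L) (p : ℕ) : Prop :=
  (∀ x y : order σ γ, ∃ m : ℤ, form σ γ lam x y = m) ∧
  ∀ x x' y y' : order σ γ, x - x' ∈ bigIdeal σ γ 𝔭 → y - y' ∈ bigIdeal σ γ 𝔭 →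
    ∃ m : ℤ, form σ γ lam x y - form σ γ lam x' y' = p * m

variable {σ γ 𝔭}

/-- The value of the induced form, computed on representatives. -/
def codeFormAux [NumberField k] {lam : L} {p : ℕ} (h : FormDescends σ γ 𝔭 lam p)
    (x y : CodeRing σ γ 𝔭) : ZMod p :=
  ((h.1 (Quotient.out x) (Quotient.out y)).choose : ℤ)

theorem codeFormAux_mk [NumberField k] {lam : L} {p : ℕ} (h : FormDescends σ γ 𝔭 lam p)
    (x y : order σ γ) (m : ℤ) (hm : form σ γ lam x y = m) :
    codeFormAux h (Ideal.Quotient.mk _ x) (Ideal.Quotient.mk _ y) = m := by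
  set X := (Ideal.Quotient.mk (bigIdeal σ γ 𝔭) x)
  set Y := (Ideal.Quotient.mk (bigIdeal σ γ 𝔭) y)
  have hX : Ideal.Quotient.mk (bigIdeal σ γ 𝔭) (Quotient.out X) = X := Quotient.out_eq X
  have hY : Ideal.Quotient.mk (bigIdeal σ γ 𝔭) (Quotient.out Y) = Y := Quotient.out_eq Y
  obtain ⟨c, hc⟩ := h.2 _ _ _ _ (Ideal.Quotient.eq.1 hX) (Ideal.Quotient.eq.1 hY)
  rw [(h.1 (Quotient.out X) (Quotient.out Y)).choose_spec, hm] at hc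
  have hc' : (h.1 (Quotient.out X) (Quotient.out Y)).choose - m = p * c := by exact_mod_cast hc
  have h2 := congrArg (Int.cast : ℤ → ZMod p) hc'
  push_cast at h2
  rw [ZMod.natCast_self, zero_mul, sub_eq_zero] at h2
  exact h2

/-- The induced form `φ : Λ/𝒫 × Λ/𝒫 → 𝔽_p`, `([x], [y]) ↦ [q_{B,λ}(x, y)]_p`
(see `codeForm_mk`). -/
def codeForm [NumberField k] {lam : L} {p : ℕ} (h : FormDescends σ γ 𝔭 lam p) :
    CodeRing σ γ 𝔭 →+ CodeRing σ γ 𝔭 →+ ZMod p :=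
  AddMonoidHom.mk' (fun x => AddMonoidHom.mk' (codeFormAux h x) (by
    intro y y'
    obtain ⟨x, rfl⟩ := Ideal.Quotient.mk_surjective x
    obtain ⟨y, rfl⟩ := Ideal.Quotient.mk_surjective y
    obtain ⟨y', rfl⟩ := Ideal.Quotient.mk_surjective y'
    obtain ⟨m, hm⟩ := h.1 x y
    obtain ⟨m', hm'⟩ := h.1 x y'
    rw [← map_add, codeFormAux_mk h x y m hm, codeFormAux_mk h x y' m' hm',
      codeFormAux_mk h x (y + y') (m + m'), Int.cast_add]
    rw [Subring.coe_add, map_add, hm, hm', Int.cast_add])) (by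
    intro x x'
    ext y
    obtain ⟨x, rfl⟩ := Ideal.Quotient.mk_surjective x
    obtain ⟨x', rfl⟩ := Ideal.Quotient.mk_surjective x'
    obtain ⟨y, rfl⟩ := Ideal.Quotient.mk_surjective y
    obtain ⟨m, hm⟩ := h.1 x y
    obtain ⟨m', hm'⟩ := h.1 x' y
    simp only [AddMonoidHom.mk'_apply, AddMonoidHom.add_apply]
    rw [← map_add, codeFormAux_mk h x y m hm, codeFormAux_mk h x' y m' hm',
      codeFormAux_mk h (x + x') y (m + m'), Int.cast_add]
    rw [Subring.coe_add, map_add, AddMonoidHom.add_apply, hm, hm', Int.cast_add])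

theorem codeForm_mk [NumberField k] {lam : L} {p : ℕ} (h : FormDescends σ γ 𝔭 lam p)
    (x y : order σ γ) (m : ℤ) (hm : form σ γ lam x y = m) :
    codeForm h (Ideal.Quotient.mk _ x) (Ideal.Quotient.mk _ y) = m :=
  codeFormAux_mk h x y m hm

/-- The dual `𝒥^⊥ = {y | φ(x, y) = 0 for all x ∈ 𝒥}`. -/
def dualCode [NumberField k] {lam : L} {p : ℕ} (h : FormDescends σ γ 𝔭 lam p)
    (J : Ideal (CodeRing σ γ 𝔭)) : Set (CodeRing σ γ 𝔭) :=
  {y | ∀ x ∈ J, codeForm h x y = 0}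

variable (𝔭) in
/-- The residue class `[λ] = [a] [b]⁻¹` modulo `𝔓 = 𝔭 𝓞_L` of an element `λ = a / b` of `L` with
`a, b ∈ 𝓞_L` outside `𝔓` (and `0` if `λ` is not of this form). -/
def residueClass (lam : L) : ResidueRing L 𝔭 :=
  open Classical in
  if h : ∃ ab : 𝓞 L × 𝓞 L, ab.1 ∉ extIdeal L 𝔭 ∧ ab.2 ∉ extIdeal L 𝔭 ∧
      lam = (ab.1 : L) / (ab.2 : L) then
    Ideal.Quotient.mk _ h.choose.1 * Ring.inverse (Ideal.Quotient.mk _ h.choose.2)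
  else 0

variable (σ 𝔭) in
/-- For `g = ∑_{i ≤ d} Xⁱ [aᵢ]`, the skew polynomial
`∑_{i ≤ d} Xⁱ [λ a*_{d-i}]^(σ̄ⁱ) ([λ a₀*]⁻¹)^(σ̄ᵈ)`. -/
def twistedReverse (lam : L) (d : ℕ) (a : ℕ → 𝓞 L) : SkewPoly (resAut σ 𝔭) :=
  ofCoeffs (resAut σ 𝔭) d fun i =>
    twist (resAut σ 𝔭) i
      (residueClass 𝔭 lam * Ideal.Quotient.mk _ (intConj L (a (d - i)))) *
    twist (resAut σ 𝔭) d
      (Ring.inverse (residueClass 𝔭 lam * Ideal.Quotient.mk _ (intConj L (a 0))))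

variable (σ γ 𝔭) in
/-- The skew polynomial `Xⁿ - [γ]` with `n = [L : k]`. -/
def centralPoly : SkewPoly (resAut σ 𝔭) :=
  var (resAut σ 𝔭) ^ Module.finrank k L -
    const (resAut σ 𝔭) (Ideal.Quotient.mk _ (algebraMap (𝓞 k) (𝓞 L) γ))

end Order

/-- The prime number `p` is unramified or tamely ramified in the number field `L`: no ramification
index of a prime ideal of `𝓞_L` above `p` is divisible by `p`. (All residue fields are finite, so
the residue extensions are separable.) -/
def IsUnramifiedOrTame (p : ℕ) (L : Type*) [Field L] : Prop :=
  ∀ 𝔔 : Ideal (𝓞 L), 𝔔.IsPrime → (p : 𝓞 L) ∈ 𝔔 → ¬ p ∣ 𝔔.ramificationIdx ℤ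

end SkewCode

/-! In `τ(x) y` the coefficient of `e⁰` only pairs equal powers of `e`, so `q_{B,λ}(x, y) = ∑ⱼ
Tr_{L/ℚ}(λ xⱼ* yⱼ)` (`form_eq_sum`). Modulo `𝒫` this is a `pairing` `∑ⱼ ψ(xⱼ* yⱼ)` on coordinates,
with `ψ([a]) = [Tr_{L/ℚ}(λ a)]_p` (`codeForm_eq_pairing`).

The functional `ψ` need not be invariant under `σ̄`, because `λ` need not lie in `k`. But `v ↦
ψ([λ]⁻¹ v)` is invariant, as it is induced by the trace itself (`traceChar_inverse_mul_resAut`); the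
factor `[λ]` is moved to `y`. For an invariant functional, right multiplication by `e` is an
isometry, since `γγ* = 1`, and right multiplication by a constant `u` has adjoint `u*`. Hence right
multiplication by `g(e)` has as adjoint, up to the unit `eᵈ`, right multiplication by the conjugated
reversal of `g` (`pairing_mul_rho`). By nondegeneracy `𝒥^⊥` is the left annihilator of the class of
`g' = ḡ_{τ̄,λ}` (`dualCode_span_rho`).

The rest is arithmetic in the skew polynomial ring over the field `𝓞_L/𝔓`. The kernel of `ρ` is
generated by the central polynomial `P = Xⁿ - [γ]` (`rho_eq_zero_iff`). Reversal is
anti-multiplicative up to a twist and maps `P` to `P` times a unit, so reversing `q g = P` produces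
the monic `h` with `h g' = g' h = P` (`exists_monic_cofactor_reverse`). Cancelling `g'` shows that
the annihilator of `ρ(g')` is generated by `ρ(h)` (`annihilator_eq_span`). Self-orthogonality then
says `ρ(g g') = 0`, and self-duality says `g = h`, since a monic divisor of `P` is determined by its
left ideal.

That `λ` is a unit at `𝔓` uses both assumptions on the form (`exists_mul_eq_of_nondegenerate`). A
zero of `λ` at `𝔓` would put an element outside `𝔓` into the radical of `φ`. A pole would make `Tr(μ
y)` divisible by `p` for all `y` and some `μ ∉ 𝔓`, which tameness forbids by independence of
characters modulo `𝔓` (`exists_trace_ne_of_tame`). -/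

namespace SkewCode

set_option linter.unusedSectionVars false

/-! ### Skew polynomials with coefficients on the right: coefficients, degrees, products -/

section SkewPolynomialArithmetic

variable {F : Type*} [CommRing F] (s : F ≃+* F)

theorem twist_zero_apply (a : F) : twist s 0 a = a := rfl

theorem twist_add_apply (i j : ℕ) (a : F) : twist s (i + j) a = twist s i (twist s j a) := by
  unfold twist; rw [pow_add]; rfl

theorem twist_one_apply (a : F) : s (twist s 1 a) = a := by
  unfold twist
  rw [pow_one]
  exact RingEquiv.apply_symm_apply s a

theorem twist_apply_of_fixed {a : F} (h : s a = a) (j : ℕ) : twist s j a = a := by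
  induction j with
  | zero => rfl
  | succ j ih =>
    rw [twist_add_apply, show twist s 1 a = a from ?_, ih]
    apply s.injective
    rw [twist_one_apply, h]

theorem pow_apply_twist (i : ℕ) (a : F) : ((s : RingAut F) ^ i) (twist s i a) = a := by
  induction i with
  | zero => rfl
  | succ i ih =>
    rw [add_comm i 1, twist_add_apply, add_comm 1 i, pow_succ]
    change ((s : RingAut F) ^ i) (s (twist s 1 _)) = a
    rw [twist_one_apply, ih]

theorem twist_pow_apply (i : ℕ) (a : F) : twist s i (((s : RingAut F) ^ i) a) = a := by
  apply ((s : RingAut F) ^ i).injective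
  rw [pow_apply_twist]

theorem twist_commute {c : F ≃+* F} (hc : ∀ a, c (s a) = s (c a)) (i : ℕ) (a : F) :
    c (twist s i a) = twist s i (c a) := by
  induction i generalizing a with
  | zero => rfl
  | succ i ih =>
    rw [twist_add_apply, twist_add_apply, ih]
    congr 1
    apply s.injective
    rw [twist_one_apply, ← hc, twist_one_apply]

theorem const_add (a b : F) : const s (a + b) = const s a + const s b := by
  unfold const; rw [map_add, map_add]

theorem const_mul (a b : F) : const s (a * b) = const s a * const s b := by
  unfold const; rw [map_mul, SkewPolynomial.C_mul]

theorem const_one : const s (1 : F) = 1 := rfl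

theorem const_zero : const s (0 : F) = 0 := by
  unfold const; rw [map_zero, map_zero]

theorem const_mul_var_pow (a : F) (i : ℕ) :
    const s a * var s ^ i = var s ^ i * const s (twist s i a) := by
  induction i with
  | zero => rw [pow_zero, one_mul, mul_one, twist_zero_apply]
  | succ i ih =>
    rw [pow_succ, ← mul_assoc, ih, mul_assoc, const_mul_var, ← mul_assoc, add_comm i 1,
      twist_add_apply]

/-- The monomial `Xⁱ b`. -/
def term (i : ℕ) : F →+ SkewPoly s where
  toFun b := var s ^ i * const s b
  map_zero' := by rw [const_zero, mul_zero]
  map_add' a b := by rw [const_add, mul_add]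

theorem term_apply (i : ℕ) (b : F) : term s i b = var s ^ i * const s b := rfl

theorem term_mul_term (i j : ℕ) (a b : F) :
    term s i a * term s j b = term s (i + j) (twist s j a * b) := by
  simp only [term_apply]
  rw [mul_assoc, ← mul_assoc (const s a), const_mul_var_pow, const_mul, pow_add]
  simp only [mul_assoc]

/-- The coefficients of `SkewPolynomial` stand to the left of `X`; moving `b` across `Xⁱ` applies
`sⁱ`. -/
theorem term_eq_monomial (i : ℕ) (b : F) :
    term s i b = SkewPolynomial.monomial i (toCoeff s (((s : RingAut F) ^ i) b)) := by
  rw [term_apply, const, var, SkewPolynomial.X_pow_eq_monomial, SkewPolynomial.monomial_mul_C,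
    one_mul, SkewPolynomial.φ_iterate_apply]
  rfl

/-- The coefficient `bₙ` of `∑ Xⁱ bᵢ`. -/
def rightCoeff (n : ℕ) : SkewPoly s →+ F where
  toFun f := twist s n ((toCoeff s).symm (SkewPolynomial.coeff f n))
  map_zero' := by rw [SkewPolynomial.coeff_zero, map_zero, map_zero]
  map_add' f g := by rw [SkewPolynomial.coeff_add, map_add, map_add]

variable {s}

theorem rightCoeff_term (n i : ℕ) (b : F) :
    rightCoeff s n (term s i b) = if i = n then b else 0 := by
  change twist s n ((toCoeff s).symm (SkewPolynomial.coeff _ n)) = _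
  rw [term_eq_monomial, SkewPolynomial.coeff_monomial]
  split_ifs with h
  · subst h
    exact twist_pow_apply s i b
  · rw [map_zero, map_zero]

theorem skewPoly_ext {f g : SkewPoly s} (h : ∀ n, rightCoeff s n f = rightCoeff s n g) :
    f = g := by
  ext n
  exact (toCoeff s).symm.injective ((twist s n).injective (h n))

theorem term_induction {P : SkewPoly s → Prop} (hm : ∀ i a, P (term s i a))
    (ha : ∀ f g, P f → P g → P (f + g)) (f : SkewPoly s) : P f := by
  refine SkewPolynomial.induction f ?_ fun n r q _ _ hq => ha _ _ ?_ hq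
  · rw [← map_zero (term s 0)]; exact hm 0 0
  · have h := term_eq_monomial s n (twist s n ((toCoeff s).symm r))
    rw [pow_apply_twist, RingEquiv.apply_symm_apply] at h
    rw [← h]
    exact hm _ _

theorem rightCoeff_mul (f g : SkewPoly s) (n : ℕ) :
    rightCoeff s n (f * g) = ∑ x ∈ Finset.HasAntidiagonal.antidiagonal n,
      twist s x.2 (rightCoeff s x.1 f) * rightCoeff s x.2 g := by
  induction f using term_induction with
  | ha f f' h h' => simp only [add_mul, map_add, h, h', Finset.sum_add_distrib]
  | hm i a =>
  induction g using term_induction with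
  | ha g g' h h' => simp only [mul_add, map_add, h, h', Finset.sum_add_distrib]
  | hm j b =>
    rw [term_mul_term]
    simp only [rightCoeff_term]
    split_ifs with h
    · rw [Finset.sum_eq_single (i, j)]
      · simp
      · rintro ⟨i', j'⟩ _ hne
        dsimp only
        by_cases hi : i = i'
        · rw [if_neg (fun hj : j = j' => hne (by rw [hi, hj])), mul_zero]
        · rw [if_neg hi, map_zero, zero_mul]
      · exact fun hx => absurd (Finset.HasAntidiagonal.mem_antidiagonal.2 h) hx
    · refine (Finset.sum_eq_zero ?_).symm
      rintro ⟨i', j'⟩ hx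
      rw [Finset.HasAntidiagonal.mem_antidiagonal] at hx
      dsimp only at hx ⊢
      by_cases hi : i = i'
      · rw [if_neg (fun hj : j = j' => h (by omega)), mul_zero]
      · rw [if_neg hi, map_zero, zero_mul]

theorem ofCoeffs_eq_sum (d : ℕ) (b : ℕ → F) :
    ofCoeffs s d b = ∑ i ∈ Finset.range (d + 1), term s i (b i) := rfl

theorem rightCoeff_ofCoeffs (n d : ℕ) (b : ℕ → F) :
    rightCoeff s n (ofCoeffs s d b) = if n ≤ d then b n else 0 := by
  rw [ofCoeffs_eq_sum, map_sum]
  simp only [rightCoeff_term, Finset.sum_ite_eq', Finset.mem_range, Nat.lt_succ_iff]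

/-- `f` has degree at most `d`. -/
def DegLE (f : SkewPoly s) (d : ℕ) : Prop := ∀ i, d < i → rightCoeff s i f = 0

theorem degLE_ofCoeffs (d : ℕ) (b : ℕ → F) : DegLE (ofCoeffs s d b) d := fun i hi => by
  rw [rightCoeff_ofCoeffs, if_neg (not_le.2 hi)]

theorem DegLE.eq_ofCoeffs {f : SkewPoly s} {d : ℕ} (h : DegLE f d) :
    f = ofCoeffs s d fun i => rightCoeff s i f := by
  refine skewPoly_ext fun n => ?_
  rw [rightCoeff_ofCoeffs]
  split_ifs with hn
  · rfl
  · exact h n (not_le.1 hn)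

theorem DegLE.isMonicOfDegree {f : SkewPoly s} {d : ℕ} (h : DegLE f d)
    (h1 : rightCoeff s d f = 1) : IsMonicOfDegree f d := ⟨_, h1, h.eq_ofCoeffs⟩

theorem DegLE.mul {f g : SkewPoly s} {m l : ℕ} (hf : DegLE f m) (hg : DegLE g l) :
    DegLE (f * g) (m + l) := fun n hn => by
  rw [rightCoeff_mul]
  refine Finset.sum_eq_zero fun x hx => ?_
  rw [Finset.HasAntidiagonal.mem_antidiagonal] at hx
  by_cases h : m < x.1
  · rw [hf _ h, map_zero, zero_mul]
  · rw [hg x.2 (by omega), mul_zero]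

/-- The bounds leave a single pair of exponents. As `twist s l` is injective, degrees add over a
domain; all degree arguments below rest on this. -/
theorem DegLE.rightCoeff_mul_top {f g : SkewPoly s} {m l : ℕ} (hf : DegLE f m) (hg : DegLE g l) :
    rightCoeff s (m + l) (f * g) = twist s l (rightCoeff s m f) * rightCoeff s l g := by
  rw [rightCoeff_mul, Finset.sum_eq_single (m, l)]
  · rintro ⟨i, j⟩ hx hne
    rw [Finset.HasAntidiagonal.mem_antidiagonal] at hx
    dsimp only at hx ⊢
    by_cases h : m < i
    · rw [hf _ h, map_zero, zero_mul]
    · by_cases h' : i = m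
      · exact absurd (by rw [h', show j = l by omega]) hne
      · rw [hg j (by omega), mul_zero]
  · exact fun hx => (hx (Finset.HasAntidiagonal.mem_antidiagonal.2 rfl)).elim

theorem rightCoeff_zero_mul (f g : SkewPoly s) :
    rightCoeff s 0 (f * g) = rightCoeff s 0 f * rightCoeff s 0 g := by
  rw [rightCoeff_mul, Finset.Nat.antidiagonal_zero, Finset.sum_singleton, twist_zero_apply]

theorem exists_degLE (f : SkewPoly s) : ∃ m, DegLE f m := by
  induction f using term_induction with
  | hm i a =>
    refine ⟨i, fun j hj => ?_⟩
    rw [rightCoeff_term, if_neg hj.ne]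
  | ha f g hf hg =>
    obtain ⟨m, hm⟩ := hf
    obtain ⟨l, hl⟩ := hg
    refine ⟨max m l, fun i hi => ?_⟩
    rw [map_add, hm i (lt_of_le_of_lt (le_max_left _ _) hi),
      hl i (lt_of_le_of_lt (le_max_right _ _) hi), add_zero]

theorem exists_degree {f : SkewPoly s} (hf : f ≠ 0) :
    ∃ m, DegLE f m ∧ rightCoeff s m f ≠ 0 := by
  classical
  have h := exists_degLE f
  refine ⟨Nat.find h, Nat.find_spec h, fun h0 => ?_⟩
  rcases Nat.eq_zero_or_pos (Nat.find h) with hz | hz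
  · refine hf (skewPoly_ext fun n => ?_)
    rw [map_zero]
    rcases Nat.eq_zero_or_pos n with hn | hn
    · rw [hn, ← hz]; exact h0
    · exact Nat.find_spec h n (by omega)
  · refine Nat.find_min h (Nat.sub_lt hz one_pos) fun i hi => ?_
    rcases Nat.lt_or_ge (Nat.find h) i with hi' | hi'
    · exact Nat.find_spec h i hi'
    · rw [show i = Nat.find h by omega]; exact h0

theorem skewPoly_eq_zero_of_mul_eq_zero [IsDomain F] {f g : SkewPoly s} (h : f * g = 0) :
    f = 0 ∨ g = 0 := by
  by_contra! hne
  obtain ⟨m, hm, hm'⟩ := exists_degree hne.1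
  obtain ⟨l, hl, hl'⟩ := exists_degree hne.2
  have h1 := hm.rightCoeff_mul_top hl
  rw [h, map_zero, eq_comm, mul_eq_zero, map_eq_zero_iff _ (twist s l).injective] at h1
  exact h1.elim hm' hl'

instance [IsDomain F] : NoZeroDivisors (SkewPoly s) := ⟨skewPoly_eq_zero_of_mul_eq_zero⟩

theorem degLE_of_mul_eq [IsDomain F] {f g P : SkewPoly s} {d n : ℕ} (hg : DegLE g d)
    (hg1 : rightCoeff s d g ≠ 0) (hP : DegLE P n) (h : g * f = P) (hf0 : f ≠ 0) :
    d ≤ n ∧ DegLE f (n - d) := by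
  obtain ⟨l, hl, hl'⟩ := exists_degree hf0
  have h1 := hg.rightCoeff_mul_top hl
  have h2 : d + l ≤ n := by
    by_contra! hlt
    rw [h, hP _ hlt, eq_comm, mul_eq_zero, map_eq_zero_iff _ (twist s l).injective] at h1
    exact h1.elim hg1 hl'
  exact ⟨by omega, fun i hi => hl i (by omega)⟩

theorem term_zero_apply (a : F) : term s 0 a = const s a := by
  rw [term_apply, pow_zero, one_mul]

theorem var_pow_eq_term (n : ℕ) : var s ^ n = term s n 1 := by
  rw [term_apply, const_one, mul_one]

variable (s) in
/-- The skew polynomial `Xⁿ - γ`. -/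
def cyclicPoly (n : ℕ) (γ : F) : SkewPoly s := var s ^ n - const s γ

/-! ### The polynomial `Xⁿ - γ`: centrality and division with remainder -/

section CyclicPoly

variable {n : ℕ} {γ : F}

theorem cyclicPoly_eq : cyclicPoly s n γ = term s n 1 - term s 0 γ := by
  rw [cyclicPoly, var_pow_eq_term, term_zero_apply]

theorem rightCoeff_cyclicPoly (i : ℕ) :
    rightCoeff s i (cyclicPoly s n γ) = (if n = i then 1 else 0) - if 0 = i then γ else 0 := by
  rw [cyclicPoly_eq, map_sub, rightCoeff_term, rightCoeff_term]

theorem degLE_cyclicPoly : DegLE (cyclicPoly s n γ) n := fun i hi => by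
  rw [rightCoeff_cyclicPoly, if_neg hi.ne, if_neg (by omega), sub_zero]

theorem rightCoeff_cyclicPoly_top (hn0 : 0 < n) : rightCoeff s n (cyclicPoly s n γ) = 1 := by
  rw [rightCoeff_cyclicPoly, if_pos rfl, if_neg hn0.ne, sub_zero]

theorem rightCoeff_cyclicPoly_zero (hn0 : 0 < n) : rightCoeff s 0 (cyclicPoly s n γ) = -γ := by
  rw [rightCoeff_cyclicPoly, if_neg hn0.ne', if_pos rfl, zero_sub]

theorem cyclicPoly_ne_zero [Nontrivial F] (hn0 : 0 < n) : cyclicPoly s n γ ≠ 0 := fun h => by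
  have h1 := rightCoeff_cyclicPoly_top (s := s) (γ := γ) hn0
  rw [h, map_zero] at h1
  exact zero_ne_one h1

/-- `Xⁿ` commutes with constants because `sⁿ = 1`, and `γ` commutes with `X` because `s` fixes it.
-/
theorem cyclicPoly_mul_comm (hn : ∀ a, twist s n a = a) (hγ : s γ = γ) (f : SkewPoly s) :
    cyclicPoly s n γ * f = f * cyclicPoly s n γ := by
  induction f using term_induction with
  | ha f g hf hg => rw [mul_add, add_mul, hf, hg]
  | hm i a =>
    rw [cyclicPoly_eq, sub_mul, mul_sub]
    simp only [term_mul_term]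
    rw [map_one, one_mul, twist_apply_of_fixed s hγ, hn, mul_one, zero_add, add_zero, add_comm,
      twist_zero_apply, mul_comm a γ]

theorem exists_eq_mul_cyclicPoly_add (hn : 0 < n) (f : SkewPoly s) :
    ∃ z r : SkewPoly s, f = z * cyclicPoly s n γ + r ∧ DegLE r (n - 1) := by
  induction f using term_induction with
  | ha f g hf hg =>
    obtain ⟨z, r, rfl, hr⟩ := hf
    obtain ⟨z', r', rfl, hr'⟩ := hg
    refine ⟨z + z', r + r', by rw [add_mul]; abel, fun i hi => ?_⟩
    rw [map_add, hr i hi, hr' i hi, add_zero]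
  | hm i a =>
    induction i using Nat.strong_induction_on generalizing a with
    | _ i ih =>
    rcases Nat.lt_or_ge i n with h | h
    · refine ⟨0, term s i a, by rw [zero_mul, zero_add], fun j hj => ?_⟩
      rw [rightCoeff_term, if_neg (by omega)]
    -- The quotient coefficient is the preimage of `a` under the twist picked up in crossing `Xⁿ`;
    -- what remains is a monomial of exponent `i - n`.
    · obtain ⟨z, r, hz, hr⟩ := ih (i - n) (by omega) (((RingEquiv.symm (twist s n)) a) * γ)
      refine ⟨z + term s (i - n) ((twist s n).symm a), r, ?_, hr⟩
      rw [add_mul, add_right_comm, ← hz, cyclicPoly_eq, mul_sub, term_mul_term, term_mul_term,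
        RingEquiv.apply_symm_apply, Nat.sub_add_cancel h, add_zero, mul_one, twist_zero_apply]
      abel

/-- With `P` central, `(g f) g = g P = P g`, and `g` can be cancelled. -/
theorem mul_comm_of_mul_eq_cyclicPoly [IsDomain F] (hn0 : 0 < n) (hn : ∀ a, twist s n a = a)
    (hγ : s γ = γ) {f g : SkewPoly s} (h : f * g = cyclicPoly s n γ) :
    g * f = cyclicPoly s n γ := by
  have hg : g ≠ 0 := by
    rintro rfl
    rw [mul_zero] at h
    exact cyclicPoly_ne_zero hn0 h.symm
  apply mul_right_cancel₀ hg
  rw [mul_assoc, h, cyclicPoly_mul_comm hn hγ]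

end CyclicPoly

/-! ### Reversal of skew polynomials and the monic cofactor of the reversed divisor -/

/-- The reversal `∑ Xⁱ bᵢ ↦ ∑ c(bᵢ) X^(m - i)` of skew polynomials of degree at most `m`. -/
def reversal (c : F ≃+* F) (m : ℕ) : SkewPoly s →+ SkewPoly s :=
  ∑ i ∈ Finset.range (m + 1), (term s (m - i)).comp
    ((twist s (m - i)).toAddMonoidHom.comp (c.toAddMonoidHom.comp (rightCoeff s i)))

theorem reversal_apply (c : F ≃+* F) (m : ℕ) (f : SkewPoly s) : reversal c m f =
    ∑ i ∈ Finset.range (m + 1), term s (m - i) (twist s (m - i) (c (rightCoeff s i f))) := by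
  rw [reversal, AddMonoidHom.finsetSum_apply]
  rfl

theorem reversal_term (c : F ≃+* F) {m i : ℕ} (hi : i ≤ m) (a : F) :
    reversal c m (term s i a) = term s (m - i) (twist s (m - i) (c a)) := by
  rw [reversal_apply, Finset.sum_eq_single i]
  · rw [rightCoeff_term, if_pos rfl]
  · intro j _ hj
    rw [rightCoeff_term, if_neg hj.symm]
    simp only [map_zero]
  · exact fun h => (h (Finset.mem_range.2 (Nat.lt_succ_of_le hi))).elim

theorem degLE_term (i : ℕ) (a : F) : DegLE (term s i a) i := fun j hj => by
  rw [rightCoeff_term, if_neg hj.ne]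

theorem DegLE.mono {f : SkewPoly s} {m l : ℕ} (h : DegLE f m) (hml : m ≤ l) : DegLE f l :=
  fun i hi => h i (lt_of_le_of_lt hml hi)

theorem degLE_sum {ι : Type*} {t : Finset ι} {f : ι → SkewPoly s} {m : ℕ}
    (h : ∀ i ∈ t, DegLE (f i) m) : DegLE (∑ i ∈ t, f i) m := fun j hj => by
  rw [map_sum]
  exact Finset.sum_eq_zero fun i hi => h i hi j hj

theorem degLE_reversal (c : F ≃+* F) (m : ℕ) (f : SkewPoly s) : DegLE (reversal c m f) m := by
  rw [reversal_apply]
  exact degLE_sum fun i _ => (degLE_term _ _).mono (Nat.sub_le _ _)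

/-- On monomials `Xⁱ a` and `Xʲ b` the product twists `a` by `j`, while in the reversed product it
sits to the right of `X^(l - j)`. The discrepancy is a twist by `l` in total, independent of `j`, so
it can be absorbed into the automorphism used for `f`. -/
theorem reversal_mul {c : F ≃+* F} (hc : ∀ a, c (s a) = s (c a)) {m l : ℕ} {f g : SkewPoly s}
    (hf : DegLE f m) (hg : DegLE g l) :
    reversal c (m + l) (f * g) = reversal c l g * reversal (c.trans (twist s l)) m f := by
  conv_lhs => rw [hf.eq_ofCoeffs, hg.eq_ofCoeffs, ofCoeffs_eq_sum, ofCoeffs_eq_sum,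
    Finset.sum_mul_sum, map_sum]
  rw [reversal_apply c l, reversal_apply _ m, Finset.sum_mul_sum, Finset.sum_comm]
  refine Finset.sum_congr rfl fun i hi => ?_
  rw [map_sum]
  refine Finset.sum_congr rfl fun j hj => ?_
  rw [Finset.mem_range, Nat.lt_succ_iff] at hi hj
  rw [term_mul_term, term_mul_term, reversal_term c (add_le_add hi hj),
    show m + l - (i + j) = (l - j) + (m - i) by omega]
  congr 1
  rw [map_mul, map_mul, twist_commute s hc, ← twist_add_apply, RingEquiv.trans_apply,
    ← twist_add_apply, ← twist_add_apply, mul_comm, add_comm (m - i) (l - j),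
    show l - j + (m - i) + j = m - i + l by omega]

/-- The reversal is `1 - Xⁿ c(γ)`, and `1 = γ c(γ)`. -/
theorem reversal_cyclicPoly {c : F ≃+* F} (hc : ∀ a, c (s a) = s (c a)) {n : ℕ} {γ : F}
    (hγ : s γ = γ) (hγc : γ * c γ = 1) :
    reversal c n (cyclicPoly s n γ) = cyclicPoly s n γ * const s (-c γ) := by
  have hcγ : s (c γ) = c γ := by rw [← hc, hγ]
  rw [cyclicPoly_eq, map_sub, reversal_term c le_rfl, reversal_term c (Nat.zero_le n),
    Nat.sub_self, Nat.sub_zero, twist_apply_of_fixed s hcγ, ← term_zero_apply,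
    sub_mul, term_mul_term, term_mul_term, twist_zero_apply, twist_zero_apply, map_one,
    one_mul, mul_neg, twist_zero_apply, hγc, map_neg, map_neg, add_zero, add_zero]
  abel

/-- The twist on `lam` in the `i`-th coefficient is what a constant on the far left acquires in
crossing `Xⁱ`. So the normalised reverse differs from the plain reversal only by constants on both
sides. -/
theorem ofCoeffs_reverse_eq (c : F ≃+* F) (d : ℕ) (b : ℕ → F) (lam κ : F) :
    (ofCoeffs s d fun i => twist s i (lam * c (b (d - i))) * κ) =
      const s lam * reversal c d (ofCoeffs s d b) * const s κ := by
  rw [reversal_apply, ofCoeffs_eq_sum, ← Finset.sum_range_reflect, Finset.mul_sum, Finset.sum_mul]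
  refine Finset.sum_congr rfl fun i hi => ?_
  rw [Finset.mem_range, Nat.lt_succ_iff] at hi
  rw [rightCoeff_ofCoeffs, if_pos hi, ← term_zero_apply, ← term_zero_apply, term_mul_term,
    term_mul_term, zero_add, add_zero, twist_zero_apply, ← map_mul,
    show d + 1 - 1 - i = d - i by omega, show d - (d - i) = i by omega]

/-- Constant terms multiply without a twist, so `b 0` divides `-γ`. -/
theorem isUnit_of_dvd_cyclicPoly {n : ℕ} (hn0 : 0 < n) {γ : F} (hγ : IsUnit γ) {d : ℕ}
    {b : ℕ → F} (hdvd : ofCoeffs s d b ∣ cyclicPoly s n γ) : IsUnit (b 0) := by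
  obtain ⟨q, hq⟩ := hdvd
  have h := rightCoeff_zero_mul (ofCoeffs s d b) q
  rw [← hq, rightCoeff_cyclicPoly_zero hn0, rightCoeff_ofCoeffs, if_pos (Nat.zero_le d)] at h
  exact isUnit_of_mul_isUnit_left (h ▸ hγ.neg)

/-- Reversing `q g = P` gives `reversal g * Q = P * (-c γ)` with `Q` a twisted reversal of `q`; the
cofactor is `Q` corrected by constants. -/
theorem exists_monic_cofactor_reverse [IsDomain F] {c : F ≃+* F} (hc : ∀ a, c (s a) = s (c a))
    {n : ℕ} (hn0 : 0 < n) (hn : ∀ a, twist s n a = a) {γ : F} (hγ : s γ = γ) (hγc : γ * c γ = 1)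
    {lam : F} (hlam : IsUnit lam) {d : ℕ} {b : ℕ → F} (hb : b d = 1)
    (hdvd : ofCoeffs s d b ∣ cyclicPoly s n γ) {g' : SkewPoly s}
    (hg' : g' = ofCoeffs s d fun i => twist s i (lam * c (b (d - i))) *
      twist s d (Ring.inverse (lam * c (b 0)))) :
    ∃ h, IsMonicOfDegree h (n - d) ∧ h * g' = cyclicPoly s n γ ∧ g' * h = cyclicPoly s n γ := by
  have hb0 : IsUnit (lam * c (b 0)) :=
    hlam.mul ((isUnit_of_dvd_cyclicPoly hn0 (IsUnit.of_mul_eq_one _ hγc) hdvd).map c)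
  obtain ⟨q, hq⟩ := hdvd
  have hq0 : q ≠ 0 := by
    rintro rfl
    rw [mul_zero] at hq
    exact cyclicPoly_ne_zero hn0 hq
  have hgd : rightCoeff s d (ofCoeffs s d b) = 1 := by
    rw [rightCoeff_ofCoeffs, if_pos le_rfl, hb]
  obtain ⟨hdn, hqd⟩ := degLE_of_mul_eq (degLE_ofCoeffs d b) (by rw [hgd]; exact one_ne_zero)
    degLE_cyclicPoly hq.symm hq0
  have hqg := mul_comm_of_mul_eq_cyclicPoly hn0 hn hγ hq.symm
  have hrev := reversal_mul hc hqd (degLE_ofCoeffs d b)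
  rw [hqg, Nat.sub_add_cancel hdn, reversal_cyclicPoly hc hγ hγc] at hrev
  have hg'' := hg'
  rw [ofCoeffs_reverse_eq] at hg''
  set Q := reversal (c.trans (twist s d)) (n - d) q
  set κ := twist s d (Ring.inverse (lam * c (b 0)))
  have hκ : κ * twist s d (lam * c (b 0)) = 1 := by
    rw [← map_mul, Ring.inverse_mul_cancel _ hb0, map_one]
  -- The left constant cancels the normalising factor `κ` of `g'`. The right one cancels `-c γ`, and
  -- also `lam`, which reaches it because `P` is central.
  have hh : g' * (const s (twist s d (lam * c (b 0))) * Q * const s (-γ * Ring.inverse lam)) =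
      cyclicPoly s n γ := by
    calc _ = const s lam * (reversal c d (ofCoeffs s d b) *
          (const s κ * const s (twist s d (lam * c (b 0)))) * Q) *
            const s (-γ * Ring.inverse lam) := by rw [hg'']; simp only [mul_assoc]
      _ = const s lam * cyclicPoly s n γ * (const s (-c γ) * const s (-γ * Ring.inverse lam)) := by
        rw [← const_mul, hκ, const_one, mul_one, ← hrev]; simp only [mul_assoc]
      _ = cyclicPoly s n γ * const s (lam * (-c γ * (-γ * Ring.inverse lam))) := by
        rw [← cyclicPoly_mul_comm hn hγ, ← const_mul, mul_assoc, ← const_mul]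
      _ = cyclicPoly s n γ := by
        rw [show lam * (-c γ * (-γ * Ring.inverse lam)) = γ * c γ * (lam * Ring.inverse lam) by
          ring, hγc, Ring.mul_inverse_cancel _ hlam, one_mul, const_one, mul_one]
  refine ⟨_, ?_, mul_comm_of_mul_eq_cyclicPoly hn0 hn hγ hh, hh⟩
  have hdeg : DegLE (const s (twist s d (lam * c (b 0))) * Q * const s (-γ * Ring.inverse lam))
      (n - d) := by
    have h := ((degLE_term (s := s) 0 (twist s d (lam * c (b 0)))).mul
      (degLE_reversal (c.trans (twist s d)) (n - d) q)).mul
      (degLE_term (s := s) 0 (-γ * Ring.inverse lam))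
    rwa [term_zero_apply, term_zero_apply, zero_add, add_zero] at h
  -- The leading coefficient is not computed from `Q`: it is forced to be `1` because `g'` and the
  -- product are monic.
  refine hdeg.isMonicOfDegree ?_
  have htop := (hg' ▸ degLE_ofCoeffs d _ : DegLE g' d).rightCoeff_mul_top hdeg
  rw [hh, Nat.add_sub_cancel' hdn, rightCoeff_cyclicPoly_top hn0] at htop
  have h1 : rightCoeff s d g' = 1 := by
    rw [hg', rightCoeff_ofCoeffs, if_pos le_rfl, Nat.sub_self, mul_comm, hκ]
  rw [h1, map_one, one_mul] at htop
  exact htop.symm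

theorem IsMonicOfDegree.degLE {f : SkewPoly s} {d : ℕ} (h : IsMonicOfDegree f d) :
    DegLE f d := by
  obtain ⟨b, _, rfl⟩ := h
  exact degLE_ofCoeffs d b

theorem IsMonicOfDegree.rightCoeff_eq_one {f : SkewPoly s} {d : ℕ} (h : IsMonicOfDegree f d) :
    rightCoeff s d f = 1 := by
  obtain ⟨b, hb, rfl⟩ := h
  rw [rightCoeff_ofCoeffs, if_pos le_rfl, hb]

theorem IsMonicOfDegree.ne_zero [Nontrivial F] {f : SkewPoly s} {d : ℕ}
    (h : IsMonicOfDegree f d) : f ≠ 0 := fun h0 => by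
  have h1 := h.rightCoeff_eq_one
  rw [h0, map_zero] at h1
  exact zero_ne_one h1

theorem IsMonicOfDegree.degLE_left_factor [IsDomain F] {f g z : SkewPoly s} {d e : ℕ}
    (hf : IsMonicOfDegree f d) (hg : IsMonicOfDegree g e) (h : f = z * g) :
    e ≤ d ∧ DegLE z (d - e) := by
  have hz : z ≠ 0 := by
    rintro rfl
    exact hf.ne_zero (by rw [h, zero_mul])
  obtain ⟨l, hl, hl'⟩ := exists_degree hz
  have h1 := hl.rightCoeff_mul_top hg.degLE
  rw [hg.rightCoeff_eq_one, mul_one, ← h] at h1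
  have h2 : l + e ≤ d := by
    by_contra! hlt
    rw [hf.degLE _ hlt, eq_comm, map_eq_zero_iff _ (twist s e).injective] at h1
    exact hl' h1
  exact ⟨by omega, fun i hi => hl i (by omega)⟩

/-- The degrees agree, so the left factor is a constant, and comparing leading coefficients makes it
`1`. -/
theorem IsMonicOfDegree.eq_of_mul_eq [IsDomain F] {f g z w : SkewPoly s} {d e : ℕ}
    (hf : IsMonicOfDegree f d) (hg : IsMonicOfDegree g e) (h : f = z * g) (h' : g = w * f) :
    f = g := by
  obtain ⟨h1, h2⟩ := hf.degLE_left_factor hg h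
  obtain rfl : d = e := le_antisymm (hg.degLE_left_factor hf h').1 h1
  rw [Nat.sub_self] at h2
  have h3 := h2.rightCoeff_mul_top hg.degLE
  rw [← h, zero_add, hf.rightCoeff_eq_one, hg.rightCoeff_eq_one, mul_one] at h3
  have h4 : z = 1 := by
    rw [← const_one, ← term_zero_apply, h2.eq_ofCoeffs, ofCoeffs_eq_sum, zero_add,
      Finset.sum_range_one]
    congr 1
    exact (twist s d).injective (h3.symm.trans (map_one _).symm)
  rw [h, h4, one_mul]

/-! ### Left annihilators and left ideals in a quotient by a central polynomial -/

section Annihilator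

variable {C : Type*} [Ring C] {ρ : SkewPoly s →+* C} {P : SkewPoly s}

/-- If `ρ(f g') = 0` then `f g'` is a multiple `z P = z h g'`, and cancelling `g'` leaves `f = z h`.
-/
theorem annihilator_eq_span [IsDomain F] (hsurj : Function.Surjective ρ)
    (hker : ∀ f, ρ f = 0 ↔ P ∣ f) (hP : ∀ f, P * f = f * P) {g' h : SkewPoly s}
    (hg' : g' ≠ 0) (hh : h * g' = P) :
    {y : C | y * ρ g' = 0} = (Ideal.span {ρ h} : Ideal C) := by
  ext y
  rw [Set.mem_ofPred_eq, SetLike.mem_coe, Ideal.mem_span_singleton']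
  constructor
  · intro hy
    obtain ⟨f, rfl⟩ := hsurj y
    rw [← map_mul, hker] at hy
    obtain ⟨z, hz⟩ := hy
    rw [hP, ← hh, ← mul_assoc] at hz
    exact ⟨ρ z, by rw [mul_right_cancel₀ hg' hz, map_mul]⟩
  · rintro ⟨z, rfl⟩
    rw [mul_assoc, ← map_mul, hh, (hker P).2 dvd_rfl, mul_zero]

theorem span_subset_annihilator_iff (hker : ∀ f, ρ f = 0 ↔ P ∣ f) (g g' : SkewPoly s) :
    ((Ideal.span {ρ g} : Ideal C) : Set C) ⊆ {y : C | y * ρ g' = 0} ↔ P ∣ g * g' := by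
  rw [← hker, map_mul]
  refine ⟨fun h => h (Ideal.mem_span_singleton_self _), fun h y hy => ?_⟩
  rw [SetLike.mem_coe, Ideal.mem_span_singleton'] at hy
  obtain ⟨z, rfl⟩ := hy
  rw [Set.mem_ofPred_eq, mul_assoc, h, mul_zero]

/-- The ambiguity in lifting is a multiple of `P`, which is itself a left multiple of `g`. -/
theorem exists_eq_mul_of_map_mem_span (hsurj : Function.Surjective ρ)
    (hker : ∀ f, ρ f = 0 ↔ P ∣ f) (hP : ∀ f, P * f = f * P) {f g q : SkewPoly s}
    (hq : q * g = P) (h : ρ f ∈ (Ideal.span {ρ g} : Ideal C)) : ∃ z, f = z * g := by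
  rw [Ideal.mem_span_singleton'] at h
  obtain ⟨y, hy⟩ := h
  obtain ⟨z, rfl⟩ := hsurj y
  rw [← map_mul, ← sub_eq_zero, ← map_sub, hker] at hy
  obtain ⟨w, hw⟩ := hy
  rw [hP, ← hq, ← mul_assoc] at hw
  exact ⟨z - w * q, by rw [sub_mul, ← hw]; abel⟩

/-- Equality of the left ideals makes `g` and `h` left multiples of each other, and both are monic,
so `g = h`. -/
theorem span_eq_annihilator_iff [IsDomain F] (hsurj : Function.Surjective ρ)
    (hker : ∀ f, ρ f = 0 ↔ P ∣ f) (hP : ∀ f, P * f = f * P) {g g' h q : SkewPoly s} {d e : ℕ}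
    (hg : IsMonicOfDegree g d) (hhm : IsMonicOfDegree h e) (hg' : g' ≠ 0) (hh : h * g' = P)
    (hh' : g' * h = P) (hq : q * g = P) :
    ((Ideal.span {ρ g} : Ideal C) : Set C) = {y : C | y * ρ g' = 0} ↔ g * g' = P := by
  rw [annihilator_eq_span hsurj hker hP hg' hh, SetLike.coe_set_eq]
  constructor
  · intro heq
    obtain ⟨z, hz⟩ := exists_eq_mul_of_map_mem_span hsurj hker hP hh'
      (heq ▸ Ideal.mem_span_singleton_self (ρ g))
    obtain ⟨w, hw⟩ := exists_eq_mul_of_map_mem_span hsurj hker hP hq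
      (heq ▸ Ideal.mem_span_singleton_self (ρ h))
    rw [hg.eq_of_mul_eq hhm hz hw, hh]
  · intro heq
    rw [mul_right_cancel₀ hg' (heq.trans hh.symm)]

end Annihilator

end SkewPolynomialArithmetic

/-! ### Coordinates on `Λ` and `Λ/𝒫`, and the kernel of `ρ` -/

section CodeRing

variable {k L : Type*} [Field k] [Field L] [Algebra k L] [FiniteDimensional k L] [IsGalois k L]

open CyclicAlgebra

theorem coord_mul_mono_zero {σ : L ≃ₐ[k] L} {γ : k} (x : CyclicAlgebra σ γ) (a : L)
    (j : Fin (Module.finrank k L)) : coord j (x * mono σ γ 0 a) = coord j x * a := by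
  induction x using CyclicAlgebra.induction with
  | ha x y hx hy => rw [add_mul, map_add, map_add, hx, hy, add_mul]
  | hm m b =>
    rw [mono_mul_mono, coord_mono, coord_mono, ite_mul, zero_mul, add_zero, mul_assoc]
    rfl

section OrderCoord

variable {σ : L ≃ₐ[k] L} {γ : 𝓞 k}

/-- The coordinate `xⱼ ∈ 𝓞_L` of `x = ∑ eʲ xⱼ ∈ Λ`. -/
def orderCoord (j : Fin (Module.finrank k L)) : order σ γ →+ 𝓞 L where
  toFun x := ⟨coord j x.1, x.2 j⟩
  map_zero' := RingOfIntegers.ext (map_zero _)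
  map_add' x y := RingOfIntegers.ext ((coord j).map_add x.1 y.1)

theorem coe_orderCoord (j : Fin (Module.finrank k L)) (x : order σ γ) :
    (orderCoord j x : L) = coord j x.1 := rfl

theorem coe_orderE_pow_mul (m : ℕ) (a : 𝓞 L) :
    (orderE σ γ ^ m * orderIncl σ γ a).1 = mono σ (γ : k) m (a : L) :=
  e_pow_mul_incl σ (γ : k) m (a : L)

theorem orderCoord_mul_orderIncl (x : order σ γ) (a : 𝓞 L) (j : Fin (Module.finrank k L)) :
    orderCoord j (x * orderIncl σ γ a) = orderCoord j x * a :=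
  RingOfIntegers.ext (coord_mul_mono_zero x.1 (a : L) j)

theorem orderCoord_orderE_pow_mul (m : ℕ) (a : 𝓞 L) (j : Fin (Module.finrank k L)) :
    orderCoord j (orderE σ γ ^ m * orderIncl σ γ a) = if m % Module.finrank k L = j
      then algebraMap (𝓞 k) (𝓞 L) γ ^ (m / Module.finrank k L) * a else 0 := by
  apply RingOfIntegers.ext
  rw [coe_orderCoord, coe_orderE_pow_mul, coord_mono]
  split_ifs
  · simp only [map_mul, map_pow]
    rfl
  · rfl

theorem order_eq_sum (x : order σ γ) :
    x = ∑ j : Fin (Module.finrank k L), orderE σ γ ^ (j : ℕ) * orderIncl σ γ (orderCoord j x) := by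
  apply Subtype.ext
  rw [AddSubmonoidClass.coe_finsetSum]
  exact eq_sum σ (γ : k) x.1

theorem orderE_pow_finrank :
    orderE σ γ ^ Module.finrank k L = orderIncl σ γ (algebraMap (𝓞 k) (𝓞 L) γ) :=
  Subtype.ext (e_pow_finrank σ (γ : k))

theorem orderCoord_mem_of_mem_bigIdeal {𝔭 : Ideal (𝓞 k)} {x : order σ γ}
    (hx : x ∈ bigIdeal σ γ 𝔭) (j : Fin (Module.finrank k L)) :
    orderCoord j x ∈ extIdeal L 𝔭 := by
  -- Quantifying over left multiples absorbs the scalars of the left ideal; on generators, right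
  -- multiplication by `𝓞_L` acts coordinatewise without twist.
  suffices h : ∀ r : order σ γ, orderCoord j (r * x) ∈ extIdeal L 𝔭 by
    simpa only [one_mul] using h 1
  unfold bigIdeal at hx
  induction hx using Submodule.span_induction with
  | zero => intro r; rw [mul_zero, map_zero]; exact Ideal.zero_mem _
  | add x x' _ _ h h' => intro r; rw [mul_add, map_add]; exact Ideal.add_mem _ (h r) (h' r)
  | smul t x _ h => intro r; rw [smul_eq_mul, ← mul_assoc]; exact h _
  | mem x hx =>
    obtain ⟨a, ha, rfl⟩ := hx
    intro r
    rw [orderCoord_mul_orderIncl]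
    exact Ideal.mul_mem_left _ _ ha

end OrderCoord

section ResidueCoord

variable (σ : L ≃ₐ[k] L) (γ : 𝓞 k) (𝔭 : Ideal (𝓞 k))

/-- The coordinate in `𝓞_L / 𝔓` of an element of `Λ/𝒫`. -/
def residueCoord (j : Fin (Module.finrank k L)) : CodeRing σ γ 𝔭 →+ ResidueRing L 𝔭 :=
  QuotientAddGroup.lift (bigIdeal σ γ 𝔭).toAddSubgroup
    ((Ideal.Quotient.mk (extIdeal L 𝔭)).toAddMonoidHom.comp (orderCoord j)) fun _ hx =>
      Ideal.Quotient.eq_zero_iff_mem.2 (orderCoord_mem_of_mem_bigIdeal hx j)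

theorem residueCoord_mk (j : Fin (Module.finrank k L)) (x : order σ γ) :
    residueCoord σ γ 𝔭 j (Ideal.Quotient.mk _ x) = Ideal.Quotient.mk _ (orderCoord j x) := rfl

/-- The element `eᵐ c` of `Λ/𝒫`. -/
def codeTerm (m : ℕ) : ResidueRing L 𝔭 →+ CodeRing σ γ 𝔭 :=
  (AddMonoidHom.mulLeft (Ideal.Quotient.mk (bigIdeal σ γ 𝔭) (orderE σ γ) ^ m)).comp
    (resIncl σ γ 𝔭).toAddMonoidHom

theorem codeTerm_apply (m : ℕ) (c : ResidueRing L 𝔭) : codeTerm σ γ 𝔭 m c =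
    Ideal.Quotient.mk (bigIdeal σ γ 𝔭) (orderE σ γ) ^ m * resIncl σ γ 𝔭 c := rfl

theorem codeTerm_mk (m : ℕ) (a : 𝓞 L) : codeTerm σ γ 𝔭 m (Ideal.Quotient.mk _ a) =
    Ideal.Quotient.mk (bigIdeal σ γ 𝔭) (orderE σ γ ^ m * orderIncl σ γ a) := by
  rw [map_mul, map_pow]
  rfl

variable (L) in
/-- The residue class of `γ` modulo `𝔓`. -/
def residueGamma : ResidueRing L 𝔭 := Ideal.Quotient.mk _ (algebraMap (𝓞 k) (𝓞 L) γ)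

theorem residueCoord_codeTerm (j : Fin (Module.finrank k L)) (m : ℕ) (c : ResidueRing L 𝔭) :
    residueCoord σ γ 𝔭 j (codeTerm σ γ 𝔭 m c) = if m % Module.finrank k L = j
      then residueGamma L γ 𝔭 ^ (m / Module.finrank k L) * c else 0 := by
  obtain ⟨a, rfl⟩ := Ideal.Quotient.mk_surjective c
  rw [codeTerm_mk, residueCoord_mk, orderCoord_orderE_pow_mul]
  split_ifs
  · rw [map_mul, map_pow]; rfl
  · rw [map_zero]

theorem codeRing_eq_sum (x : CodeRing σ γ 𝔭) :
    x = ∑ j : Fin (Module.finrank k L), codeTerm σ γ 𝔭 j (residueCoord σ γ 𝔭 j x) := by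
  obtain ⟨x, rfl⟩ := Ideal.Quotient.mk_surjective x
  conv_lhs => rw [order_eq_sum x, map_sum]
  exact Finset.sum_congr rfl fun j _ => (codeTerm_mk σ γ 𝔭 j _).symm

variable {σ γ 𝔭} in
theorem codeRing_ext {x y : CodeRing σ γ 𝔭}
    (h : ∀ j, residueCoord σ γ 𝔭 j x = residueCoord σ γ 𝔭 j y) : x = y := by
  rw [codeRing_eq_sum σ γ 𝔭 x, codeRing_eq_sum σ γ 𝔭 y]
  simp only [h]

theorem rho_term (i : ℕ) (c : ResidueRing L 𝔭) :
    rho σ γ 𝔭 (term (resAut σ 𝔭) i c) = codeTerm σ γ 𝔭 i c := by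
  obtain ⟨a, rfl⟩ := Ideal.Quotient.mk_surjective c
  rw [term_apply, map_mul, map_pow, rho_var, rho_const]
  rfl

theorem rho_surjective : Function.Surjective (rho σ γ 𝔭) := fun x =>
  ⟨∑ j : Fin (Module.finrank k L), term (resAut σ 𝔭) j (residueCoord σ γ 𝔭 j x), by
    rw [map_sum, codeRing_eq_sum σ γ 𝔭 x]
    simp only [rho_term, ← codeRing_eq_sum]⟩

theorem centralPoly_eq : centralPoly σ γ 𝔭 =
    cyclicPoly (resAut σ 𝔭) (Module.finrank k L) (residueGamma L γ 𝔭) := rfl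

theorem rho_centralPoly : rho σ γ 𝔭 (centralPoly σ γ 𝔭) = 0 := by
  rw [centralPoly, map_sub, map_pow, rho_var, rho_const, ← map_pow, orderE_pow_finrank, sub_self]

theorem resAut_residueGamma : resAut σ 𝔭 (residueGamma L γ 𝔭) = residueGamma L γ 𝔭 := by
  change Ideal.Quotient.mk _ (intAut σ (algebraMap (𝓞 k) (𝓞 L) γ)) = Ideal.Quotient.mk _ _
  congr 1
  exact RingOfIntegers.ext (σ.commutes (γ : k))

theorem twist_resAut_mk (j : ℕ) (a : 𝓞 L) : twist (resAut σ 𝔭) j (Ideal.Quotient.mk _ a) =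
    Ideal.Quotient.mk _ (twist (intAut σ) j a) := by
  induction j generalizing a with
  | zero => rfl
  | succ j ih => rw [twist_add_apply, twist_add_apply, ← ih]; rfl

theorem coe_twist_intAut (j : ℕ) (a : 𝓞 L) :
    ((twist (intAut σ) j a : 𝓞 L) : L) = twist σ.toRingEquiv j (a : L) := by
  induction j generalizing a with
  | zero => rfl
  | succ j ih => rw [twist_add_apply, twist_add_apply, ih]; rfl

theorem twist_resAut_finrank (c : ResidueRing L 𝔭) :
    twist (resAut σ 𝔭) (Module.finrank k L) c = c := by
  obtain ⟨a, rfl⟩ := Ideal.Quotient.mk_surjective c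
  rw [twist_resAut_mk]
  congr 1
  apply RingOfIntegers.ext
  have h := twist_finrank_mul σ 1 (a : L)
  rw [mul_one] at h
  rw [coe_twist_intAut, h]

theorem centralPoly_mul_comm (f : SkewPoly (resAut σ 𝔭)) :
    centralPoly σ γ 𝔭 * f = f * centralPoly σ γ 𝔭 :=
  cyclicPoly_mul_comm (twist_resAut_finrank σ 𝔭) (resAut_residueGamma σ γ 𝔭) f

/-- Below degree `n` the relation `eⁿ = γ` never enters, so coordinates and right coefficients
coincide. -/
theorem residueCoord_rho {r : SkewPoly (resAut σ 𝔭)} (hr : DegLE r (Module.finrank k L - 1))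
    (j : Fin (Module.finrank k L)) :
    residueCoord σ γ 𝔭 j (rho σ γ 𝔭 r) = rightCoeff _ j r := by
  have hn : 0 < Module.finrank k L := Module.finrank_pos
  rw [hr.eq_ofCoeffs, ofCoeffs_eq_sum, Nat.sub_add_cancel hn, map_sum, map_sum, map_sum]
  refine Finset.sum_congr rfl fun i hi => ?_
  rw [Finset.mem_range] at hi
  rw [rho_term, residueCoord_codeTerm, rightCoeff_term, Nat.mod_eq_of_lt hi, Nat.div_eq_of_lt hi,
    pow_zero, one_mul]

/-- Divide by `P`: the remainder has degree below `n`, and its coefficients are the coordinates of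
its image. -/
theorem rho_eq_zero_iff (f : SkewPoly (resAut σ 𝔭)) :
    rho σ γ 𝔭 f = 0 ↔ centralPoly σ γ 𝔭 ∣ f := by
  constructor
  · intro hf
    obtain ⟨z, r, rfl, hr⟩ := exists_eq_mul_cyclicPoly_add (s := resAut σ 𝔭)
      (γ := residueGamma L γ 𝔭) (Module.finrank_pos : 0 < Module.finrank k L) f
    rw [← centralPoly_eq] at hf ⊢
    rw [map_add, map_mul, rho_centralPoly, mul_zero, zero_add] at hf
    have hr0 : r = 0 := by
      refine skewPoly_ext fun i => ?_
      rw [map_zero]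
      rcases Nat.lt_or_ge i (Module.finrank k L) with hi | hi
      · rw [← residueCoord_rho σ γ 𝔭 hr ⟨i, hi⟩, hf, map_zero]
      · exact hr i (by have : 0 < Module.finrank k L := Module.finrank_pos
                       omega)
    rw [hr0, add_zero, ← centralPoly_mul_comm]
    exact dvd_mul_right _ _
  · rintro ⟨z, rfl⟩
    rw [map_mul, rho_centralPoly, zero_mul]

end ResidueCoord

end CodeRing

/-! ### Complex conjugation on `L`, `k` and the residue ring -/

section Conjugation

variable {k L : Type*} [Field k] [NumberField k] [Field L] [NumberField L] [Algebra k L]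
  [IsGalois k L]

/-- Conjugation is characterised at every embedding, in particular at both `f` and `f ∘ s`. -/
theorem complexConj_comp_ringEquiv (hL : IsTotallyReal L ∨ IsCMField L) (s : L ≃+* L) (x : L) :
    complexConj L (s x) = s (complexConj L x) := by
  obtain ⟨f⟩ : Nonempty (L →+* ℂ) := inferInstance
  apply f.injective
  rw [complexConj_spec L hL f]
  exact (complexConj_spec L hL (f.comp s.toRingHom) x).symm

theorem complexConj_complexConj (hL : IsTotallyReal L ∨ IsCMField L) (x : L) :
    complexConj L (complexConj L x) = x := by
  obtain ⟨f⟩ : Nonempty (L →+* ℂ) := inferInstance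
  apply f.injective
  rw [complexConj_spec L hL f, complexConj_spec L hL f, starRingEnd_self_apply]

theorem exists_algebraMap_eq_complexConj (hL : IsTotallyReal L ∨ IsCMField L) (x : k) :
    ∃ y : k, algebraMap k L y = complexConj L (algebraMap k L x) := by
  rw [← Set.mem_range, IsGalois.mem_range_algebraMap_iff_fixed]
  intro s
  exact (complexConj_comp_ringEquiv hL s.toRingEquiv (algebraMap k L x)).symm.trans
    (congrArg (complexConj L) (s.commutes x))

/-- Conjugation of `L` commutes with the Galois group, hence preserves `k`. Its restriction
satisfies the defining property there, so `complexConj k` is not the dummy identity. -/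
theorem algebraMap_complexConj (hL : IsTotallyReal L ∨ IsCMField L) (x : k) :
    algebraMap k L (complexConj k x) = complexConj L (algebraMap k L x) := by
  have hex : ∃ c : k ≃+* k, ∀ (f : k →+* ℂ) (x : k), f (c x) = starRingEnd ℂ (f x) := by
    choose c hc using exists_algebraMap_eq_complexConj (k := k) hL
    have hinj := (algebraMap k L).injective
    refine ⟨{ toFun := c, invFun := c, left_inv := fun x => hinj ?_,
              right_inv := fun x => hinj ?_, map_mul' := fun x y => hinj ?_,
              map_add' := fun x y => hinj ?_ }, fun f x => ?_⟩
    · rw [hc, hc, complexConj_complexConj hL]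
    · rw [hc, hc, complexConj_complexConj hL]
    · rw [hc, map_mul, map_mul, map_mul, hc, hc]
    · rw [hc, map_add, map_add, map_add, hc, hc]
    -- Each embedding of `k` extends to `L`, where conjugation is already understood.
    · let F : L →+* ℂ :=
        let := f.toAlgebra
        (IsAlgClosed.lift : L →ₐ[k] ℂ).toRingHom
      have hF : ∀ z, F (algebraMap k L z) = f z := fun z => by
        let := f.toAlgebra
        exact (IsAlgClosed.lift : L →ₐ[k] ℂ).commutes z
      change f (c x) = _
      rw [← hF, ← hF, hc, complexConj_spec L hL F]
  obtain ⟨f⟩ : Nonempty (L →+* ℂ) := inferInstance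
  apply f.injective
  rw [complexConj_spec L hL f, complexConj, dif_pos hex]
  exact hex.choose_spec (f.comp (algebraMap k L)) x

theorem algebraMap_intConj (hL : IsTotallyReal L ∨ IsCMField L) (x : 𝓞 k) :
    algebraMap (𝓞 k) (𝓞 L) (intConj k x) = intConj L (algebraMap (𝓞 k) (𝓞 L) x) :=
  RingOfIntegers.ext (algebraMap_complexConj hL (x : k))

theorem map_intConj_extIdeal (hL : IsTotallyReal L ∨ IsCMField L) {𝔭 : Ideal (𝓞 k)}
    (hconj : 𝔭.map (intConj k) = 𝔭) :
    extIdeal L 𝔭 = (extIdeal L 𝔭).map (intConj L : 𝓞 L →+* 𝓞 L) := by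
  conv_lhs => rw [← hconj]
  change Ideal.map _ (Ideal.map (intConj k : 𝓞 k →+* 𝓞 k) 𝔭) = _
  rw [Ideal.map_map, Ideal.map_map]
  exact congrArg (fun f => Ideal.map f 𝔭) (RingHom.ext fun x => algebraMap_intConj hL x)

/-- Complex conjugation on `𝓞_L / 𝔓`. -/
def resConj (hL : IsTotallyReal L ∨ IsCMField L) {𝔭 : Ideal (𝓞 k)}
    (hconj : 𝔭.map (intConj k) = 𝔭) : ResidueRing L 𝔭 ≃+* ResidueRing L 𝔭 :=
  Ideal.quotientEquiv _ _ (intConj L) (map_intConj_extIdeal hL hconj)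

variable (hL : IsTotallyReal L ∨ IsCMField L) {𝔭 : Ideal (𝓞 k)} (hconj : 𝔭.map (intConj k) = 𝔭)

theorem resConj_mk (a : 𝓞 L) : resConj hL hconj (Ideal.Quotient.mk _ a) =
    Ideal.Quotient.mk _ (intConj L a) := rfl

theorem resConj_resAut (σ : L ≃ₐ[k] L) (u : ResidueRing L 𝔭) :
    resConj hL hconj (resAut σ 𝔭 u) = resAut σ 𝔭 (resConj hL hconj u) := by
  obtain ⟨a, rfl⟩ := Ideal.Quotient.mk_surjective u
  change Ideal.Quotient.mk _ (intConj L (intAut σ a)) =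
    Ideal.Quotient.mk _ (intAut σ (intConj L a))
  congr 1
  exact RingOfIntegers.ext (complexConj_comp_ringEquiv hL σ.toRingEquiv (a : L))

theorem residueGamma_mul_resConj {γ : 𝓞 k} (hγ : γ * intConj k γ = 1) :
    residueGamma L γ 𝔭 * resConj hL hconj (residueGamma L γ 𝔭) = 1 := by
  rw [residueGamma, resConj_mk, ← algebraMap_intConj hL, ← map_mul, ← map_mul, hγ, map_one,
    map_one]

end Conjugation

/-! ### Adjoints for the coordinate pairing on `Λ/𝒫` -/

section Pairing

variable {k L : Type*} [Field k] [Field L] [Algebra k L] [FiniteDimensional k L] [IsGalois k L]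
variable {σ : L ≃ₐ[k] L} {γ : 𝓞 k} {𝔭 : Ideal (𝓞 k)}

theorem codeTerm_mul_codeTerm (m l : ℕ) (a b : ResidueRing L 𝔭) :
    codeTerm σ γ 𝔭 m a * codeTerm σ γ 𝔭 l b =
      codeTerm σ γ 𝔭 (m + l) (twist (resAut σ 𝔭) l a * b) := by
  rw [← rho_term, ← rho_term, ← map_mul, term_mul_term, rho_term]

theorem isUnit_codeTerm (hγ : IsUnit (residueGamma L γ 𝔭)) (m : ℕ) :
    IsUnit (codeTerm σ γ 𝔭 m 1) := by
  rw [codeTerm_apply, map_one, mul_one]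
  refine IsUnit.pow m ?_
  rw [← isUnit_pow_iff (Module.finrank_pos : 0 < Module.finrank k L).ne', ← map_pow,
    orderE_pow_finrank]
  exact hγ.map (resIncl σ γ 𝔭)

theorem codeTerm_induction {P : CodeRing σ γ 𝔭 → Prop}
    (hm : ∀ i < Module.finrank k L, ∀ a, P (codeTerm σ γ 𝔭 i a))
    (ha : ∀ x y, P x → P y → P (x + y)) (x : CodeRing σ γ 𝔭) : P x := by
  rw [codeRing_eq_sum σ γ 𝔭 x]
  refine Finset.sum_induction _ P ha ?_ fun j _ => hm _ j.2 _
  rw [← map_zero (codeTerm σ γ 𝔭 0)]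
  exact hm 0 Module.finrank_pos 0

variable {A : Type*} [AddCommGroup A] (ψ : ResidueRing L 𝔭 →+ A)
  (c : ResidueRing L 𝔭 ≃+* ResidueRing L 𝔭)

/-- The pairing `(x, y) ↦ ∑ ψ(c(xⱼ) yⱼ)` on `Λ/𝒫`. -/
def pairing (x y : CodeRing σ γ 𝔭) : A :=
  ∑ j, ψ (c (residueCoord σ γ 𝔭 j x) * residueCoord σ γ 𝔭 j y)

theorem pairing_add_left (x x' y : CodeRing σ γ 𝔭) :
    pairing ψ c (x + x') y = pairing ψ c x y + pairing ψ c x' y := by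
  simp only [pairing, map_add, add_mul, Finset.sum_add_distrib]

theorem pairing_add_right (x y y' : CodeRing σ γ 𝔭) :
    pairing ψ c x (y + y') = pairing ψ c x y + pairing ψ c x y' := by
  simp only [pairing, map_add, mul_add, Finset.sum_add_distrib]

theorem pairing_zero_right (x : CodeRing σ γ 𝔭) : pairing ψ c x 0 = 0 := by
  simp only [pairing, map_zero, mul_zero, Finset.sum_const_zero]

theorem pairing_sum_left {ι : Type*} (t : Finset ι) (x : ι → CodeRing σ γ 𝔭)
    (y : CodeRing σ γ 𝔭) : pairing ψ c (∑ i ∈ t, x i) y = ∑ i ∈ t, pairing ψ c (x i) y :=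
  map_sum (AddMonoidHom.mk' (fun x => pairing ψ c x y) fun _ _ => pairing_add_left ψ c _ _ _) _ _

theorem pairing_sum_right {ι : Type*} (t : Finset ι) (x : CodeRing σ γ 𝔭)
    (y : ι → CodeRing σ γ 𝔭) : pairing ψ c x (∑ i ∈ t, y i) = ∑ i ∈ t, pairing ψ c x (y i) :=
  map_sum (AddMonoidHom.mk' (fun y => pairing ψ c x y) fun _ _ => pairing_add_right ψ c _ _ _) _ _

theorem pairing_codeTerm_of_ne {m l : ℕ}
    (h : m % Module.finrank k L ≠ l % Module.finrank k L) (a b : ResidueRing L 𝔭) :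
    pairing ψ c (codeTerm σ γ 𝔭 m a) (codeTerm σ γ 𝔭 l b) = 0 := by
  refine Finset.sum_eq_zero fun j _ => ?_
  rw [residueCoord_codeTerm, residueCoord_codeTerm]
  by_cases hm : m % Module.finrank k L = j
  · rw [if_neg (fun hl : l % Module.finrank k L = j => h (hm.trans hl.symm)), mul_zero, map_zero]
  · rw [if_neg hm, map_zero, zero_mul, map_zero]

/-- For `m ≥ n` both terms reduce with the same power of `γ`, and these powers cancel by `γ c(γ) =
1`. -/
theorem pairing_codeTerm_self (hγ : residueGamma L γ 𝔭 * c (residueGamma L γ 𝔭) = 1) (m : ℕ)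
    (a b : ResidueRing L 𝔭) :
    pairing ψ c (codeTerm σ γ 𝔭 m a) (codeTerm σ γ 𝔭 m b) = ψ (c a * b) := by
  rw [pairing, Finset.sum_eq_single ⟨m % Module.finrank k L, Nat.mod_lt _ Module.finrank_pos⟩]
  · rw [residueCoord_codeTerm, residueCoord_codeTerm, if_pos rfl, if_pos rfl, map_mul c, map_pow]
    congr 1
    rw [mul_mul_mul_comm, ← mul_pow, mul_comm (c _), hγ, one_pow, one_mul]
  · intro j _ hj
    rw [residueCoord_codeTerm, if_neg (fun h => hj (Fin.ext h.symm)), map_zero, zero_mul, map_zero]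
  · exact fun h => (h (Finset.mem_univ _)).elim

theorem residueCoord_mul_codeTerm_zero (x : CodeRing σ γ 𝔭) (u : ResidueRing L 𝔭)
    (j : Fin (Module.finrank k L)) : residueCoord σ γ 𝔭 j (x * codeTerm σ γ 𝔭 0 u) =
      residueCoord σ γ 𝔭 j x * u := by
  induction x using codeTerm_induction with
  | ha x y hx hy => rw [add_mul, map_add, map_add, hx, hy, add_mul]
  | hm i _ a =>
    rw [codeTerm_mul_codeTerm, residueCoord_codeTerm, residueCoord_codeTerm, add_zero,
      twist_zero_apply, ite_mul, zero_mul, mul_assoc]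

theorem pairing_mul_const (u : ResidueRing L 𝔭) (x y : CodeRing σ γ 𝔭) : pairing ψ c (x * codeTerm σ γ 𝔭 0 u) y =
      pairing ψ c x (y * codeTerm σ γ 𝔭 0 (c u)) := by
  simp only [pairing, residueCoord_mul_codeTerm_zero, map_mul]
  exact Finset.sum_congr rfl fun j _ => by congr 1; ring

/-- Multiplying by `eⁱ` shifts exponents and twists all coordinates alike; `ψ` does not see the
twist, nor the pairing the wrap-around factors `γ`. -/
theorem pairing_mul_codeTerm_one (hγ : residueGamma L γ 𝔭 * c (residueGamma L γ 𝔭) = 1)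
    (hc : ∀ v, c (resAut σ 𝔭 v) = resAut σ 𝔭 (c v)) (hψ : ∀ v, ψ (resAut σ 𝔭 v) = ψ v)
    (i : ℕ) (x y : CodeRing σ γ 𝔭) :
    pairing ψ c (x * codeTerm σ γ 𝔭 i 1) (y * codeTerm σ γ 𝔭 i 1) = pairing ψ c x y := by
  have hψ' : ∀ v, ψ (twist (resAut σ 𝔭) i v) = ψ v := by
    intro v
    induction i generalizing v with
    | zero => rfl
    | succ i ih => rw [twist_add_apply, ih, ← hψ, twist_one_apply]
  induction x using codeTerm_induction with
  | ha x x' h h' => rw [add_mul, pairing_add_left, pairing_add_left, h, h']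
  | hm m hm a =>
  induction y using codeTerm_induction with
  | ha y y' h h' => rw [add_mul, pairing_add_right, pairing_add_right, h, h']
  | hm l hl b =>
    rw [codeTerm_mul_codeTerm, codeTerm_mul_codeTerm, mul_one, mul_one]
    by_cases hml : m = l
    · subst hml
      rw [pairing_codeTerm_self ψ c hγ, pairing_codeTerm_self ψ c hγ, twist_commute _ hc,
        ← map_mul, hψ']
    · rw [pairing_codeTerm_of_ne, pairing_codeTerm_of_ne]
      · rwa [Nat.mod_eq_of_lt hm, Nat.mod_eq_of_lt hl]
      · intro h
        have h1 := Nat.ModEq.add_right_cancel' i h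
        rw [Nat.ModEq, Nat.mod_eq_of_lt hm, Nat.mod_eq_of_lt hl] at h1
        exact hml h1

/-- For a single term, `⟨x eⁱ a, y⟩ = ⟨x eⁱ, y c(a)⟩ = ⟨x eᵈ, y c(a) e^(d-i)⟩`. Multiplying by
`e^(d-i)` gives every term the same left argument `x eᵈ`. -/
theorem pairing_mul_rho (hγ : residueGamma L γ 𝔭 * c (residueGamma L γ 𝔭) = 1)
    (hc : ∀ v, c (resAut σ 𝔭 v) = resAut σ 𝔭 (c v)) (hψ : ∀ v, ψ (resAut σ 𝔭 v) = ψ v)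
    {d : ℕ} {g : SkewPoly (resAut σ 𝔭)} (hg : DegLE g d) (x y : CodeRing σ γ 𝔭) :
    pairing ψ c (x * rho σ γ 𝔭 g) y =
      pairing ψ c (x * codeTerm σ γ 𝔭 d 1) (y * rho σ γ 𝔭 (reversal c d g)) := by
  conv_lhs => rw [hg.eq_ofCoeffs, ofCoeffs_eq_sum, map_sum, Finset.mul_sum, pairing_sum_left]
  rw [reversal_apply, map_sum, Finset.mul_sum, pairing_sum_right]
  refine Finset.sum_congr rfl fun i hi => ?_
  rw [Finset.mem_range, Nat.lt_succ_iff] at hi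
  set a := rightCoeff (resAut σ 𝔭) i g
  have h1 : codeTerm σ γ 𝔭 i a = codeTerm σ γ 𝔭 i 1 * codeTerm σ γ 𝔭 0 a := by
    rw [codeTerm_mul_codeTerm, map_one (twist _ _), one_mul, add_zero]
  have h2 : codeTerm σ γ 𝔭 d 1 = codeTerm σ γ 𝔭 i 1 * codeTerm σ γ 𝔭 (d - i) 1 := by
    rw [codeTerm_mul_codeTerm, map_one (twist _ _), one_mul, Nat.add_sub_cancel' hi]
  have h3 : codeTerm σ γ 𝔭 (d - i) (twist (resAut σ 𝔭) (d - i) (c a)) =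
      codeTerm σ γ 𝔭 0 (c a) * codeTerm σ γ 𝔭 (d - i) 1 := by
    rw [codeTerm_mul_codeTerm, mul_one, zero_add]
  rw [rho_term, rho_term, h1, h2, h3, ← mul_assoc, ← mul_assoc, ← mul_assoc,
    pairing_mul_codeTerm_one ψ c hγ hc hψ, pairing_mul_const ψ c]

theorem eq_zero_of_pairing_eq_zero (hγ : residueGamma L γ 𝔭 * c (residueGamma L γ 𝔭) = 1)
    (hnd : ∀ v, (∀ u, ψ (u * v) = 0) → v = 0) {y : CodeRing σ γ 𝔭}
    (hy : ∀ x, pairing ψ c x y = 0) : y = 0 := by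
  refine codeRing_ext fun j => ?_
  rw [map_zero]
  refine hnd _ fun u => ?_
  have h := hy (codeTerm σ γ 𝔭 j (c.symm u))
  rw [codeRing_eq_sum σ γ 𝔭 y, pairing_sum_right, Finset.sum_eq_single j] at h
  · rwa [pairing_codeTerm_self ψ c hγ, RingEquiv.apply_symm_apply] at h
  · intro i _ hij
    rw [pairing_codeTerm_of_ne]
    rw [Nat.mod_eq_of_lt j.2, Nat.mod_eq_of_lt i.2]
    exact fun h => hij (Fin.ext h.symm)
  · exact fun h => (h (Finset.mem_univ _)).elim

/-- After passing to the adjoint, `x eᵈ` runs over the whole ring because `e` is a unit, so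
nondegeneracy applies; the unit `κ` does not change the annihilator. -/
theorem forall_pairing_mul_rho_eq_zero_iff
    (hγ : residueGamma L γ 𝔭 * c (residueGamma L γ 𝔭) = 1)
    (hc : ∀ v, c (resAut σ 𝔭 v) = resAut σ 𝔭 (c v)) (hψ : ∀ v, ψ (resAut σ 𝔭 v) = ψ v)
    (hnd : ∀ v, (∀ u, ψ (u * v) = 0) → v = 0) {d : ℕ} {g : SkewPoly (resAut σ 𝔭)}
    (hg : DegLE g d) (lam : ResidueRing L 𝔭) {κ : ResidueRing L 𝔭} (hκ : IsUnit κ)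
    (y : CodeRing σ γ 𝔭) :
    (∀ x, pairing ψ c (x * rho σ γ 𝔭 g) (y * codeTerm σ γ 𝔭 0 lam) = 0) ↔
      y * rho σ γ 𝔭 (const _ lam * reversal c d g * const _ κ) = 0 := by
  simp only [pairing_mul_rho ψ c hγ hc hψ hg]
  have hu : IsUnit (rho σ γ 𝔭 (const _ κ)) := by
    have h : IsUnit (const (resAut σ 𝔭) κ) := by
      obtain ⟨κ', hκ'⟩ := hκ.exists_right_inv
      exact ⟨⟨const _ κ, const _ κ', by rw [← const_mul, hκ', const_one],
        by rw [← const_mul, mul_comm, hκ', const_one]⟩, rfl⟩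
    exact h.map (rho σ γ 𝔭)
  rw [map_mul, ← mul_assoc, hu.mul_left_eq_zero, map_mul, ← term_zero_apply, rho_term,
    ← mul_assoc]
  constructor
  · intro h
    refine eq_zero_of_pairing_eq_zero ψ c hγ hnd fun x => ?_
    obtain ⟨v, hv⟩ := (isUnit_codeTerm (σ := σ) (IsUnit.of_mul_eq_one _ hγ) d).exists_left_inv
    have h1 := h (x * v)
    rwa [mul_assoc, hv, mul_one] at h1
  · intro h x
    rw [h, pairing_zero_right]

end Pairing

/-! ### The trace form in coordinates -/

section TraceForm

variable {k L : Type*} [Field k] [Field L] [Algebra k L] [FiniteDimensional k L] [IsGalois k L]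

open CyclicAlgebra

theorem eInv_pow (σ : L ≃ₐ[k] L) (γ : k) (i : ℕ) : eInv σ γ ^ i =
    mono σ γ ((Module.finrank k L - 1) * i) (algebraMap k L (γ⁻¹ ^ i)) := by
  induction i with
  | zero => rw [pow_zero, pow_zero, map_one, mul_zero, one_def]
  | succ i ih =>
    rw [pow_succ, ih, eInv, e_pow_mul_incl, mono_mul_mono, twist_algebraMap, ← map_mul,
      ← pow_succ, mul_add, mul_one]

/-- With `e⁻ⁱ = e^((n-1)i) γ⁻ⁱ` the exponent is `(n-1)i + j`, divisible by `n` only for `i = j`. It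
is then `n i`, which twists trivially and contributes `γⁱ`. -/
theorem coord_zero_mul_eInv_pow_mul_mono (σ : L ≃ₐ[k] L) {γ : k} (hγ : γ ≠ 0)
    (i j : Fin (Module.finrank k L)) (a b : L) :
    coord 0 (incl σ γ a * eInv σ γ ^ (i : ℕ) * mono σ γ j b) = if i = j then a * b else 0 := by
  have hn : 0 < Module.finrank k L := Module.finrank_pos
  change coord 0 (mono σ γ 0 a * _ * _) = _
  rw [eInv_pow, mono_mul_mono, mono_mul_mono, coord_mono, zero_add, Fin.val_zero]
  by_cases hij : i = j
  · subst hij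
    have h1 : (Module.finrank k L - 1) * (i : ℕ) + i = Module.finrank k L * i := by
      rw [← Nat.succ_mul, Nat.succ_eq_add_one, Nat.sub_add_cancel hn]
    rw [if_pos rfl, h1, if_pos (Nat.mul_mod_right _ _), Nat.mul_div_cancel_left _ hn, map_mul,
      twist_algebraMap, ← twist_add, add_comm, h1, twist_finrank_mul, map_pow, map_inv₀]
    have h2 : algebraMap k L γ ≠ 0 := (map_ne_zero _).2 hγ
    rw [inv_pow]
    field_simp
  · rw [if_neg hij, if_neg]
    intro h
    apply hij
    have h1 : (Module.finrank k L - 1) * (i : ℕ) + j ≡ (Module.finrank k L - 1) * i + i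
        [MOD Module.finrank k L] := by
      rw [Nat.ModEq, h, ← Nat.succ_mul, Nat.succ_eq_add_one, Nat.sub_add_cancel hn,
        Nat.mul_mod_right]
    have h2 := Nat.ModEq.add_left_cancel' _ h1
    rw [Nat.ModEq, Nat.mod_eq_of_lt i.2, Nat.mod_eq_of_lt j.2] at h2
    exact Fin.ext h2.symm

theorem reducedTrace_mul_tau_mul (σ : L ≃ₐ[k] L) {γ : k} (hγ : γ ≠ 0) (lam : L)
    (x y : CyclicAlgebra σ γ) : reducedTrace σ γ (incl σ γ lam * tau σ γ x * y) =
      ∑ j, Algebra.trace k L (lam * (complexConj L (coord j x) * coord j y)) := by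
  change Algebra.trace k L (coord 0 _) = _
  conv_lhs => rw [tau_apply, ← sum_mono σ γ y, Finset.mul_sum Finset.univ _ (incl σ γ lam),
    Finset.sum_mul_sum, map_sum]
  rw [← map_sum (Algebra.trace k L)]
  congr 1
  refine Finset.sum_congr rfl fun i _ => ?_
  rw [map_sum, Finset.sum_eq_single i]
  · rw [← mul_assoc, ← map_mul, coord_zero_mul_eInv_pow_mul_mono σ hγ, if_pos rfl, mul_assoc]
  · intro j _ hj
    rw [← mul_assoc, ← map_mul, coord_zero_mul_eInv_pow_mul_mono σ hγ, if_neg hj.symm]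
  · exact fun h => (h (Finset.mem_univ _)).elim

end TraceForm

/-! ### The induced form modulo `p` as a coordinate pairing -/

section CodeForm

variable {k L : Type*} [Field k] [NumberField k] [Field L] [NumberField L] [Algebra k L]
  [IsGalois k L] {σ : L ≃ₐ[k] L} {γ : 𝓞 k} {𝔭 : Ideal (𝓞 k)}

open CyclicAlgebra

theorem form_eq_sum (hγ : (γ : k) ≠ 0) (lam : L) (x y : CyclicAlgebra σ (γ : k)) :
    form σ γ lam x y =
      ∑ j, Algebra.trace ℚ L (lam * (complexConj L (coord j x) * coord j y)) := by
  rw [form_apply, reducedTrace_mul_tau_mul σ hγ, map_sum]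
  simp only [Algebra.trace_trace]

theorem orderCoord_orderIncl (a : 𝓞 L) (j : Fin (Module.finrank k L)) :
    orderCoord j (orderIncl σ γ a) = if j = 0 then a else 0 := by
  have h := orderCoord_orderE_pow_mul (σ := σ) (γ := γ) 0 a j
  rw [pow_zero, one_mul, Nat.zero_mod, Nat.zero_div, pow_zero, one_mul] at h
  rw [h]
  congr 1
  rw [eq_iff_iff, Fin.ext_iff, Fin.val_zero, eq_comm]

theorem form_orderIncl (hγ : (γ : k) ≠ 0) (lam : L) (a : 𝓞 L) (y : order σ γ) :
    form σ γ lam (orderIncl σ γ a) y =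
      Algebra.trace ℚ L (lam * (intConj L a * orderCoord 0 y : 𝓞 L)) := by
  rw [form_eq_sum hγ, Finset.sum_eq_single 0]
  · rw [← coe_orderCoord, orderCoord_orderIncl, if_pos rfl]
    rfl
  · intro j _ hj
    rw [← coe_orderCoord, orderCoord_orderIncl, if_neg hj]
    simp
  · exact fun h => (h (Finset.mem_univ _)).elim

variable {lam : L} {p : ℕ} (hwd : FormDescends σ γ 𝔭 lam p)
include hwd

theorem exists_trace_eq_int (hγ : (γ : k) ≠ 0) (a : 𝓞 L) :
    ∃ m : ℤ, Algebra.trace ℚ L (lam * a) = m := by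
  obtain ⟨m, hm⟩ := hwd.1 (orderIncl σ γ 1) (orderIncl σ γ a)
  rw [form_orderIncl hγ, orderCoord_orderIncl, if_pos rfl, map_one, one_mul] at hm
  exact ⟨m, hm⟩

/-- The additive map `𝓞_L / 𝔓 → 𝔽_p`, `[a] ↦ [Tr_{L/ℚ}(λ a)]_p`. -/
def traceChar : ResidueRing L 𝔭 →+ ZMod p :=
  (codeForm hwd 1).comp (resIncl σ γ 𝔭).toAddMonoidHom

theorem traceChar_mk (hγ : (γ : k) ≠ 0) {a : 𝓞 L} {m : ℤ}
    (h : Algebra.trace ℚ L (lam * a) = m) : traceChar hwd (Ideal.Quotient.mk _ a) = m := by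
  refine codeForm_mk hwd 1 (orderIncl σ γ a) m ?_
  rw [← map_one (orderIncl σ γ), form_orderIncl hγ, orderCoord_orderIncl, if_pos rfl, map_one,
    one_mul, h]

theorem codeForm_eq_pairing (hγ : (γ : k) ≠ 0) (c : ResidueRing L 𝔭 ≃+* ResidueRing L 𝔭)
    (hc : ∀ a, c (Ideal.Quotient.mk _ a) = Ideal.Quotient.mk _ (intConj L a))
    (x y : CodeRing σ γ 𝔭) : codeForm hwd x y = pairing (traceChar hwd) c x y := by
  obtain ⟨x, rfl⟩ := Ideal.Quotient.mk_surjective x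
  obtain ⟨y, rfl⟩ := Ideal.Quotient.mk_surjective y
  choose m hm using fun j : Fin (Module.finrank k L) =>
    exists_trace_eq_int hwd hγ (intConj L (orderCoord j x) * orderCoord j y)
  rw [codeForm_mk hwd x y (∑ j, m j), pairing, Int.cast_sum]
  · refine Finset.sum_congr rfl fun j _ => ?_
    rw [residueCoord_mk, residueCoord_mk, hc, ← map_mul, traceChar_mk hwd hγ (hm j)]
  · rw [form_eq_sum hγ, Int.cast_sum]
    exact Finset.sum_congr rfl fun j _ => hm j

/-- An element of the radical of `ψ`, placed in the coordinate of `e⁰` after undoing the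
conjugation, lies in the radical of `φ`. -/
theorem traceChar_nondegenerate (hγ : (γ : k) ≠ 0)
    (hnd : ∀ x, (∀ y, codeForm hwd x y = 0) → x = 0)
    (c : ResidueRing L 𝔭 ≃+* ResidueRing L 𝔭)
    (hc : ∀ a, c (Ideal.Quotient.mk _ a) = Ideal.Quotient.mk _ (intConj L a))
    {v : ResidueRing L 𝔭} (hv : ∀ u, traceChar hwd (v * u) = 0) : v = 0 := by
  have h : codeTerm σ γ 𝔭 0 (c.symm v) = 0 := by
    refine hnd _ fun y => ?_
    rw [codeForm_eq_pairing hwd hγ c hc]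
    refine Finset.sum_eq_zero fun j _ => ?_
    rw [residueCoord_codeTerm]
    split_ifs
    · rw [Nat.zero_div, pow_zero, one_mul, RingEquiv.apply_symm_apply, hv]
    · rw [map_zero, zero_mul, map_zero]
  have h1 := residueCoord_codeTerm σ γ 𝔭 0 0 (c.symm v)
  rw [h, map_zero, if_pos (by rw [Nat.zero_mod, Fin.val_zero]), Nat.zero_div, pow_zero, one_mul,
    eq_comm, map_eq_zero_iff _ c.symm.injective] at h1
  exact h1

theorem dvd_trace_of_mem (hγ : (γ : k) ≠ 0) {a : 𝓞 L} (ha : a ∈ extIdeal L 𝔭) :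
    ∃ m : ℤ, Algebra.trace ℚ L (lam * a) = p * m := by
  obtain ⟨m, hm⟩ := hwd.2 (orderIncl σ γ 1) (orderIncl σ γ 1) (orderIncl σ γ a) 0
    (by rw [sub_self]; exact Ideal.zero_mem _)
    (by rw [sub_zero]; exact Ideal.mem_map_of_mem _ ha)
  refine ⟨m, ?_⟩
  rw [← hm, form_orderIncl hγ, form_orderIncl hγ, orderCoord_orderIncl, if_pos rfl, map_one,
    one_mul, map_zero, mul_zero]
  simp

theorem mem_extIdeal_of_dvd_trace (hγ : (γ : k) ≠ 0)
    (hnd : ∀ x, (∀ y, codeForm hwd x y = 0) → x = 0)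
    (c : ResidueRing L 𝔭 ≃+* ResidueRing L 𝔭)
    (hc : ∀ a, c (Ideal.Quotient.mk _ a) = Ideal.Quotient.mk _ (intConj L a))
    {s : 𝓞 L} (hs : ∀ y : 𝓞 L, ∃ m : ℤ, Algebra.trace ℚ L (lam * (s * y : 𝓞 L)) = p * m) :
    s ∈ extIdeal L 𝔭 := by
  rw [← Ideal.Quotient.eq_zero_iff_mem]
  refine traceChar_nondegenerate hwd hγ hnd c hc fun u => ?_
  obtain ⟨y, rfl⟩ := Ideal.Quotient.mk_surjective u
  obtain ⟨m, hm⟩ := hs y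
  rw [← map_mul, traceChar_mk hwd hγ (m := p * m) (by rw [hm]; push_cast; rfl)]
  push_cast
  rw [ZMod.natCast_self, zero_mul]

end CodeForm

/-! ### Traces modulo `p` and tame ramification -/

section Trace

/-- The maps `y ↦ g y mod P` are multiplicative with values in a domain, so distinct ones are
linearly independent. Group the vanishing sum by equal maps: the identity map occurs once for each
inertia element, with total coefficient `|I| μ`. -/
theorem natCast_card_inertia_mul_mem {G S : Type*} [Group G] [Finite G] [CommRing S]
    [MulSemiringAction G S] (P : Ideal S) [P.IsPrime] {μ : S}
    (h : ∀ y, ∑ᶠ g : G, g • (μ * y) ∈ P) : (Nat.card (P.inertia G) : S) * μ ∈ P := by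
  classical
  let _ : Fintype G := Fintype.ofFinite G
  let χ : G → S →* S ⧸ P := fun g =>
    (Ideal.Quotient.mk P : S →* S ⧸ P).comp (MulSemiringAction.toRingHom G S g : S →* S)
  have hχ : ∀ g y, χ g y = Ideal.Quotient.mk P (g • y) := fun _ _ => rfl
  have hli := linearIndependent_iff'.1 (linearIndependent_monoidHom S (S ⧸ P))
    (Finset.univ.image χ) (fun f => ∑ g ∈ Finset.univ.filter (fun g => χ g = f), χ g μ) (by
      ext y
      rw [Finset.sum_apply, Pi.zero_apply]
      have h1 := Ideal.Quotient.eq_zero_iff_mem.2 (h y)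
      rw [finsum_eq_sum_of_fintype, map_sum] at h1
      rw [← h1, ← Finset.sum_fiberwise_of_maps_to (t := Finset.univ.image χ) (g := χ)
        fun g _ => Finset.mem_image_of_mem χ (Finset.mem_univ g)]
      refine Finset.sum_congr rfl fun f _ => ?_
      rw [Pi.smul_apply, smul_eq_mul, Finset.sum_mul]
      refine Finset.sum_congr rfl fun g hg => ?_
      rw [← (Finset.mem_filter.1 hg).2, ← map_mul, hχ]) (χ 1)
    (Finset.mem_image_of_mem χ (Finset.mem_univ 1))
  have hmem : ∀ g, χ g = χ 1 ↔ g ∈ P.inertia G := by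
    intro g
    rw [MonoidHom.ext_iff]
    refine forall_congr' fun y => ?_
    rw [hχ, hχ, one_smul, Ideal.Quotient.eq]
    rfl
  rw [Finset.sum_congr rfl (fun g hg => by
    rw [(Finset.mem_filter.1 hg).2]), Finset.sum_const, hχ, one_smul, nsmul_eq_mul] at hli
  rw [← Ideal.Quotient.eq_zero_iff_mem, map_mul, map_natCast, ← hli, Nat.card_eq_fintype_card,
    Fintype.card_subtype]
  simp only [hmem]

variable {L : Type*} [Field L] [NumberField L] [IsGalois ℚ L]

theorem coe_sum_smul (x : 𝓞 L) :
    ((∑ᶠ g : Gal(L/ℚ), g • x : 𝓞 L) : L) = algebraMap ℚ L (Algebra.trace ℚ L x) := by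
  rw [trace_eq_sum_automorphisms, finsum_eq_sum_of_fintype]
  exact map_sum (algebraMap (𝓞 L) L) _ _

theorem sum_smul_eq_intCast {x : 𝓞 L} {m : ℤ} (h : Algebra.trace ℚ L x = m) :
    ∑ᶠ g : Gal(L/ℚ), g • x = (m : 𝓞 L) := by
  apply RingOfIntegers.ext
  rw [coe_sum_smul, h]
  simp

variable {p : ℕ} [Fact p.Prime] {P : Ideal (𝓞 L)} [P.IsPrime]

theorem dvd_of_intCast_mem (hp : (p : 𝓞 L) ∈ P) {m : ℤ} (hm : (m : 𝓞 L) ∈ P) :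
    (p : ℤ) ∣ m := by
  by_contra hdvd
  have hcop : IsCoprime (p : ℤ) m :=
    (Nat.prime_iff_prime_int.1 (Fact.out : p.Prime)).irreducible.coprime_iff_not_dvd.2 hdvd
  obtain ⟨u, v, huv⟩ := hcop
  refine Ideal.IsPrime.ne_top ‹P.IsPrime› ((Ideal.eq_top_iff_one _).2 ?_)
  have h1 : ((u * p + v * m : ℤ) : 𝓞 L) = 1 := by rw [huv, Int.cast_one]
  rw [← h1]
  push_cast
  exact P.add_mem (P.mul_mem_left _ hp) (P.mul_mem_left _ hm)

theorem card_inertia_eq_ramificationIdx :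
    Nat.card (P.inertia Gal(L/ℚ)) = P.ramificationIdx ℤ := by
  have := IsGaloisGroup.of_isFractionRing Gal(L/ℚ) ℤ (𝓞 L) ℚ L
  rw [Ideal.card_inertia_eq_ramificationIdxIn (P.under ℤ) P,
    Ideal.ramificationIdxIn_eq_ramificationIdx (P.under ℤ) P Gal(L/ℚ)]

/-- Otherwise `|I| μ ∈ P`, hence `|I| ∈ P`; but `|I|` is the ramification index, which is prime to
`p`. -/
theorem exists_trace_ne_of_tame (htame : IsUnramifiedOrTame p L) (hp : (p : 𝓞 L) ∈ P)
    {μ : 𝓞 L} (hμ : μ ∉ P) :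
    ∃ y : 𝓞 L, ∀ m : ℤ, Algebra.trace ℚ L (μ * y : 𝓞 L) ≠ p * m := by
  by_contra! h
  have h1 : (Nat.card (P.inertia Gal(L/ℚ)) : 𝓞 L) * μ ∈ P := by
    refine natCast_card_inertia_mul_mem P fun y => ?_
    obtain ⟨m, hm⟩ := h y
    rw [sum_smul_eq_intCast (m := p * m) (by rw [hm]; push_cast; rfl)]
    push_cast
    exact P.mul_mem_right _ hp
  have h2 := (Ideal.IsPrime.mem_or_mem ‹P.IsPrime› h1).resolve_right hμ
  rw [card_inertia_eq_ramificationIdx, ← Int.cast_natCast] at h2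
  exact htame P inferInstance hp (Int.natCast_dvd_natCast.1 (dvd_of_intCast_mem hp h2))

theorem exists_trace_eq_of_forall_mem (hp : (p : 𝓞 L) ∈ P) {t : 𝓞 L}
    (ht : ∀ Q : Ideal (𝓞 L), Q.IsPrime → (p : 𝓞 L) ∈ Q → t ∈ Q) :
    ∃ m : ℤ, Algebra.trace ℚ L t = p * m := by
  obtain ⟨m, hm⟩ := (IsIntegrallyClosed.isIntegral_iff (R := ℤ)).1
    (Algebra.isIntegral_trace (L := ℚ) (RingOfIntegers.isIntegral_coe t))
  have hm' : Algebra.trace ℚ L t = m := hm.symm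
  have h1 : (m : 𝓞 L) ∈ P := by
    rw [← sum_smul_eq_intCast hm', finsum_eq_sum_of_fintype]
    refine P.sum_mem fun g _ => ?_
    -- `g t ∈ P` means that `t` lies in the preimage of `P` under `g`, again a prime above `p`.
    refine ht (P.comap (MulSemiringAction.toRingHom Gal(L/ℚ) (𝓞 L) g)) inferInstance ?_
    rw [Ideal.mem_comap, map_natCast]
    exact hp
  obtain ⟨c, rfl⟩ := dvd_of_intCast_mem hp h1
  exact ⟨c, by rw [hm']; push_cast; rfl⟩

/-- Write `(p) = Pᵐ A` with `P ∤ A` and take `w ∈ A` outside `P`. Any other prime above `p` cannot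
contain the maximal ideal `P`, so it contains `A`. -/
theorem exists_notMem_and_mem_of_ne (hP : P ≠ ⊥) :
    ∃ w ∉ P, ∀ Q : Ideal (𝓞 L), Q.IsPrime → (p : 𝓞 L) ∈ Q → Q ≠ P → w ∈ Q := by
  have hprime : Prime P := Ideal.prime_of_isPrime hP inferInstance
  have hp0 : (p : 𝓞 L) ≠ 0 := Nat.cast_ne_zero.2 (Fact.out : p.Prime).ne_zero
  have hI : Ideal.span {(p : 𝓞 L)} ≠ 0 := by
    rwa [Ne, Ideal.zero_eq_bot, Ideal.span_singleton_eq_bot]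
  obtain ⟨A, hA, hPA⟩ := (FiniteMultiplicity.of_prime_left hprime hI).exists_eq_pow_mul_and_not_dvd
  rw [Ideal.dvd_iff_le, SetLike.not_le_iff_exists] at hPA
  obtain ⟨w, hwA, hwP⟩ := hPA
  refine ⟨w, hwP, fun Q hQ hpQ hne => ?_⟩
  have h1 : Ideal.span {(p : 𝓞 L)} ≤ Q := (Ideal.span_singleton_le_iff_mem _).2 hpQ
  rw [hA] at h1
  rcases hQ.mul_le.1 h1 with h2 | h2
  · have hmax : P.IsMaximal := Ideal.IsPrime.isMaximal inferInstance hP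
    exact (hne (hmax.eq_of_le hQ.ne_top (hQ.le_of_pow_le h2)).symm).elim
  · exact h2 hwA

end Trace

/-! ### `λ` is a unit at `𝔓` -/

section Valuation

variable {k L : Type*} [Field k] [NumberField k] [Field L] [NumberField L] [Algebra k L]
  [IsGalois k L] [IsGalois ℚ L] {σ : L ≃ₐ[k] L} {γ : 𝓞 k} {𝔭 : Ideal (𝓞 k)}
  {lam : L} {p : ℕ} [Fact p.Prime] (hwd : FormDescends σ γ 𝔭 lam p)
include hwd

theorem exists_mul_eq_of_nondegenerate (htame : IsUnramifiedOrTame p L)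
    (hp : (p : 𝓞 k) ∈ 𝔭) (𝔓 : IsDedekindDomain.HeightOneSpectrum (𝓞 L))
    (hinert : 𝔓.asIdeal = extIdeal L 𝔭) (hγ : (γ : k) ≠ 0)
    (hnd : ∀ x, (∀ y, codeForm hwd x y = 0) → x = 0)
    (c : ResidueRing L 𝔭 ≃+* ResidueRing L 𝔭)
    (hc : ∀ a, c (Ideal.Quotient.mk _ a) = Ideal.Quotient.mk _ (intConj L a)) :
    ∃ a b : 𝓞 L, a ∉ extIdeal L 𝔭 ∧ b ∉ extIdeal L 𝔭 ∧ lam * b = a := by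
  rw [← hinert]
  have hpP : (p : 𝓞 L) ∈ 𝔓.asIdeal := by
    rw [hinert, ← map_natCast (algebraMap (𝓞 k) (𝓞 L))]
    exact Ideal.mem_map_of_mem _ hp
  obtain ⟨n, ⟨d, hd⟩, h | h⟩ := 𝔓.exists_primeCompl_mul_eq_or_mul_eq lam
  · refine ⟨n, d, fun hn => ?_, hd, h⟩
    -- Suppose `λ` vanishes at `𝔓`. The factor `w` puts `n w y = λ d w y` into all primes above `p`,
    -- so `d w` is in the radical of `φ` although it is outside `𝔓`.
    obtain ⟨w, hw, hwQ⟩ := exists_notMem_and_mem_of_ne (p := p) 𝔓.ne_bot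
    have hdw : d * w ∈ 𝔓.asIdeal := by
      rw [hinert]
      refine mem_extIdeal_of_dvd_trace hwd hγ hnd c hc fun y => ?_
      have h1 : lam * (d * w * y : 𝓞 L) = ((n * w * y : 𝓞 L) : L) := by
        simp only [map_mul, ← mul_assoc]
        rw [h]
      rw [h1]
      refine exists_trace_eq_of_forall_mem hpP fun Q hQ hpQ => ?_
      by_cases hne : Q = 𝔓.asIdeal
      · rw [hne, mul_assoc]
        exact Ideal.mul_mem_right _ _ hn
      · exact Q.mul_mem_right _ (Q.mul_mem_left _ (hwQ Q hQ hpQ hne))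
    exact (𝔓.isPrime.mem_or_mem hdw).elim hd hw
  · refine ⟨d, n, hd, fun hn => ?_, h⟩
    -- Suppose `λ` has a pole at `𝔓`. As `n ∈ 𝔓`, well-definedness makes `Tr(λ n y) = Tr(d y)`
    -- divisible by `p` for every `y`.
    obtain ⟨y, hy⟩ := exists_trace_ne_of_tame htame hpP hd
    obtain ⟨m, hm⟩ := dvd_trace_of_mem hwd hγ (a := n * y)
      (by rw [← hinert]; exact Ideal.mul_mem_right _ _ hn)
    refine hy m ?_
    have h1 : lam * (n * y : 𝓞 L) = ((d * y : 𝓞 L) : L) := by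
      simp only [map_mul, ← mul_assoc]
      rw [h]
    rw [← hm, h1]

end Valuation

/-! ### The residue class of `λ` and the dual code as an annihilator -/

section ResidueClass

variable {k L : Type*} [Field k] [NumberField k] [Field L] [NumberField L] [Algebra k L]
  [IsGalois k L] {𝔭 : Ideal (𝓞 k)}

theorem isUnit_mk_of_notMem [(extIdeal L 𝔭).IsMaximal] {a : 𝓞 L} (ha : a ∉ extIdeal L 𝔭) :
    IsUnit (Ideal.Quotient.mk (extIdeal L 𝔭) a) := by
  have hF := (Ideal.Quotient.maximal_ideal_iff_isField_quotient (extIdeal L 𝔭)).1 inferInstance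
  obtain ⟨b, hb⟩ := hF.mul_inv_cancel (a := Ideal.Quotient.mk (extIdeal L 𝔭) a)
    fun h => ha (Ideal.Quotient.eq_zero_iff_mem.1 h)
  exact IsUnit.of_mul_eq_one b hb

theorem exists_mk_mul_residueClass [(extIdeal L 𝔭).IsMaximal] {lam : L}
    (h : ∃ a b : 𝓞 L, a ∉ extIdeal L 𝔭 ∧ b ∉ extIdeal L 𝔭 ∧ lam * b = a) :
    ∃ a b : 𝓞 L, a ∉ extIdeal L 𝔭 ∧ b ∉ extIdeal L 𝔭 ∧ lam * b = a ∧
      Ideal.Quotient.mk (extIdeal L 𝔭) b * residueClass 𝔭 lam = Ideal.Quotient.mk _ a := by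
  have hne : ∀ b : 𝓞 L, b ∉ extIdeal L 𝔭 → (b : L) ≠ 0 := fun b hb h0 =>
    hb (RingOfIntegers.coe_eq_zero_iff.1 h0 ▸ Ideal.zero_mem _)
  have hex : ∃ ab : 𝓞 L × 𝓞 L, ab.1 ∉ extIdeal L 𝔭 ∧ ab.2 ∉ extIdeal L 𝔭 ∧
      lam = (ab.1 : L) / (ab.2 : L) := by
    obtain ⟨a, b, ha, hb, hab⟩ := h
    exact ⟨(a, b), ha, hb, by rw [eq_div_iff (hne b hb), hab]⟩
  obtain ⟨h1, h2, h3⟩ := hex.choose_spec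
  refine ⟨hex.choose.1, hex.choose.2, h1, h2, ?_, ?_⟩
  · rwa [eq_div_iff (hne _ h2)] at h3
  · rw [residueClass, dif_pos hex, mul_left_comm,
      Ring.mul_inverse_cancel _ (isUnit_mk_of_notMem h2), mul_one]

theorem intAut_notMem (g : L ≃ₐ[k] L) {a : 𝓞 L} (ha : a ∉ extIdeal L 𝔭) :
    intAut g a ∉ extIdeal L 𝔭 := fun h => by
  rw [← Ideal.Quotient.eq_zero_iff_mem] at h ha
  exact ha ((map_eq_zero_iff (resAut g 𝔭) (resAut g 𝔭).injective).1 h)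

theorem exists_fixed_numerator [(extIdeal L 𝔭).IsPrime] (σ : L ≃ₐ[k] L) {lam : L}
    {u : ResidueRing L 𝔭}
    (h : ∃ a b : 𝓞 L, a ∉ extIdeal L 𝔭 ∧ b ∉ extIdeal L 𝔭 ∧ lam * b = a ∧
      Ideal.Quotient.mk (extIdeal L 𝔭) b * u = Ideal.Quotient.mk _ a) :
    ∃ a b : 𝓞 L, a ∉ extIdeal L 𝔭 ∧ intAut σ a = a ∧ lam * b = a ∧
      Ideal.Quotient.mk (extIdeal L 𝔭) b * u = Ideal.Quotient.mk _ a := by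
  classical
  obtain ⟨a, b, ha, -, hab, hu⟩ := h
  -- Multiplying numerator and denominator by the other conjugates of `a` turns the numerator into
  -- the norm of `a`, which `σ` fixes. It stays outside `𝔓` because the Galois group of `L/k`
  -- preserves `𝔓`.
  set κ := ∏ g ∈ Finset.univ.erase (1 : L ≃ₐ[k] L), intAut g a
  have hκ : a * κ = ∏ g : L ≃ₐ[k] L, intAut g a :=
    Finset.mul_prod_erase _ (fun g : L ≃ₐ[k] L => intAut g a) (Finset.mem_univ 1)
  refine ⟨a * κ, b * κ, ?_, ?_, ?_, ?_⟩
  · rw [hκ, Ideal.IsPrime.prod_mem_iff]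
    rintro ⟨g, -, hg⟩
    exact intAut_notMem g ha hg
  · rw [hκ, map_prod]
    exact Fintype.prod_equiv (Equiv.mulLeft σ) _ _ fun g => rfl
  · simp only [map_mul, ← mul_assoc]
    rw [hab]
  · rw [map_mul, map_mul, mul_right_comm, hu]

variable {σ : L ≃ₐ[k] L} {γ : 𝓞 k} {lam : L} {p : ℕ}

theorem trace_mul_intAut {lam : L} {a b : 𝓞 L} (ha : intAut σ a = a) (hab : lam * b = a)
    (t : 𝓞 L) : Algebra.trace ℚ L (lam * (b * intAut σ t : 𝓞 L)) =
      Algebra.trace ℚ L (lam * (b * t : 𝓞 L)) := by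
  have h : ∀ t : 𝓞 L, lam * (b * t : 𝓞 L) = ((a * t : 𝓞 L) : L) := fun t => by
    simp only [map_mul, ← mul_assoc]
    rw [hab]
  rw [h, h, ← Algebra.trace_eq_of_algEquiv (σ.restrictScalars ℚ) ((a * t : 𝓞 L) : L)]
  congr 1
  have h1 : intAut σ (a * t) = a * intAut σ t := by rw [map_mul, ha]
  rw [← h1]
  rfl

/-- With `λ = a/b` and `σ(a) = a`, the value at `v = [a t]` is `[Tr(λ b t)] = [Tr(a t)]`, and the
trace is invariant under `σ`. -/
theorem traceChar_inverse_mul_resAut [(extIdeal L 𝔭).IsMaximal]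
    (hwd : FormDescends σ γ 𝔭 lam p) (hγ : (γ : k) ≠ 0) {u : ResidueRing L 𝔭} (hu : IsUnit u)
    (h : ∃ a b : 𝓞 L, a ∉ extIdeal L 𝔭 ∧ b ∉ extIdeal L 𝔭 ∧ lam * b = a ∧
      Ideal.Quotient.mk (extIdeal L 𝔭) b * u = Ideal.Quotient.mk _ a) (v : ResidueRing L 𝔭) :
    traceChar hwd (Ring.inverse u * resAut σ 𝔭 v) = traceChar hwd (Ring.inverse u * v) := by
  obtain ⟨a, b, ha, hσa, hab, hbu⟩ := exists_fixed_numerator σ h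
  have key : ∀ t, Ring.inverse u * Ideal.Quotient.mk _ (a * t) = Ideal.Quotient.mk _ (b * t) := by
    intro t
    rw [map_mul, ← hbu, map_mul, ← mul_assoc, mul_left_comm, Ring.inverse_mul_cancel _ hu, mul_one]
  obtain ⟨t, rfl⟩ : ∃ t, v = Ideal.Quotient.mk _ (a * t) := by
    obtain ⟨w, hw⟩ := (isUnit_mk_of_notMem ha).exists_right_inv
    obtain ⟨t, ht⟩ := Ideal.Quotient.mk_surjective (w * v)
    exact ⟨t, by rw [map_mul, ht, ← mul_assoc, hw, one_mul]⟩
  have h1 : resAut σ 𝔭 (Ideal.Quotient.mk _ (a * t)) =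
      Ideal.Quotient.mk _ (a * intAut σ t) := by
    change Ideal.Quotient.mk _ (intAut σ (a * t)) = _
    rw [map_mul, hσa]
  rw [h1, key, key]
  obtain ⟨m, hm⟩ := exists_trace_eq_int hwd hγ (b * t)
  rw [traceChar_mk hwd hγ hm, traceChar_mk hwd hγ ((trace_mul_intAut hσa hab t).trans hm)]

theorem pairing_comp_mulLeft {c : ResidueRing L 𝔭 ≃+* ResidueRing L 𝔭} {A : Type*}
    [AddCommGroup A] (ψ : ResidueRing L 𝔭 →+ A) {u : ResidueRing L 𝔭} (hu : IsUnit u)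
    (x y : CodeRing σ γ 𝔭) : pairing ψ c x y =
      pairing (ψ.comp (AddMonoidHom.mulLeft (Ring.inverse u))) c x (y * codeTerm σ γ 𝔭 0 u) := by
  refine Finset.sum_congr rfl fun j _ => ?_
  rw [residueCoord_mul_codeTerm_zero]
  change _ = ψ (Ring.inverse u * _)
  congr 1
  rw [mul_left_comm, mul_left_comm (Ring.inverse u), mul_comm _ u, Ring.mul_inverse_cancel _ hu, mul_one]

/-- The adjoint calculation is applied to the invariant functional `ψ(u⁻¹ ·)`; the compensating
factor `u` on `y` becomes the left constant of the annihilated polynomial. -/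
theorem dualCode_span_rho [(extIdeal L 𝔭).IsMaximal]
    (hwd : FormDescends σ γ 𝔭 lam p) (hnd : ∀ x, (∀ y, codeForm hwd x y = 0) → x = 0)
    (hγ : (γ : k) ≠ 0) {c : ResidueRing L 𝔭 ≃+* ResidueRing L 𝔭}
    (hc : ∀ a, c (Ideal.Quotient.mk _ a) = Ideal.Quotient.mk _ (intConj L a))
    (hγc : residueGamma L γ 𝔭 * c (residueGamma L γ 𝔭) = 1)
    (hcσ : ∀ v, c (resAut σ 𝔭 v) = resAut σ 𝔭 (c v)) {u : ResidueRing L 𝔭} (hu : IsUnit u)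
    (h : ∃ a b : 𝓞 L, a ∉ extIdeal L 𝔭 ∧ b ∉ extIdeal L 𝔭 ∧ lam * b = a ∧
      Ideal.Quotient.mk (extIdeal L 𝔭) b * u = Ideal.Quotient.mk _ a)
    {d : ℕ} {g : SkewPoly (resAut σ 𝔭)} (hg : DegLE g d) {κ : ResidueRing L 𝔭} (hκ : IsUnit κ) :
    dualCode hwd (codeIdeal σ γ 𝔭 g) =
      {y | y * rho σ γ 𝔭 (const _ u * reversal c d g * const _ κ) = 0} := by
  ext y
  rw [Set.mem_ofPred_eq, ← forall_pairing_mul_rho_eq_zero_iff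
    ((traceChar hwd).comp (AddMonoidHom.mulLeft (Ring.inverse u))) c hγc hcσ
    (traceChar_inverse_mul_resAut hwd hγ hu h) ?_ hg u hκ y]
  · simp only [← pairing_comp_mulLeft _ hu, ← codeForm_eq_pairing hwd hγ c hc]
    change (∀ x ∈ codeIdeal σ γ 𝔭 g, _) ↔ _
    simp only [codeIdeal, Ideal.mem_span_singleton', forall_exists_index,
      forall_apply_eq_imp_iff]
  · intro v hv
    have h1 : Ring.inverse u * v = 0 := by
      refine traceChar_nondegenerate hwd hγ hnd c hc fun w => ?_
      rw [← hv w]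
      change _ = traceChar hwd (Ring.inverse u * (w * v))
      congr 1
      ring
    rw [← one_mul v, ← Ring.mul_inverse_cancel _ hu, mul_assoc, h1, mul_zero]

end ResidueClass

end SkewCode

/-! ### Assembly -/

theorem mainTheorem5 {k L : Type*} [Field k] [NumberField k] [Field L] [NumberField L]
    [Algebra k L] [IsGalois k L] [IsGalois ℚ L]
    (hL : NumberField.IsTotallyReal L ∨ NumberField.IsCMField L)
    (σ : L ≃ₐ[k] L) (hσ : ∀ s : L ≃ₐ[k] L, s ∈ Subgroup.zpowers σ)
    (γ : NumberField.RingOfIntegers k) (hγ : γ * SkewCode.intConj k γ = 1)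
    (lam : L) (hlam : SkewCode.IsTotallyPositive lam)
    (p : ℕ) [Fact p.Prime] (htame : SkewCode.IsUnramifiedOrTame p L)
    (𝔭 : Ideal (NumberField.RingOfIntegers k)) [𝔭.IsPrime]
    (hp : (p : NumberField.RingOfIntegers k) ∈ 𝔭)
    (hconj : 𝔭.map (SkewCode.intConj k) = 𝔭)
    (𝔓 : IsDedekindDomain.HeightOneSpectrum (NumberField.RingOfIntegers L))
    (hinert : 𝔓.asIdeal = 𝔭.map (algebraMap (NumberField.RingOfIntegers k)
      (NumberField.RingOfIntegers L)))
    (hwd : SkewCode.FormDescends σ γ 𝔭 lam p)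
    (hnd : ∀ x, (∀ y, SkewCode.codeForm hwd x y = 0) → x = 0)
    (d : ℕ) (a : ℕ → NumberField.RingOfIntegers L)
    (g : SkewCode.SkewPoly (SkewCode.resAut σ 𝔭))
    (hg : g = SkewCode.ofCoeffs (SkewCode.resAut σ 𝔭) d fun i => Ideal.Quotient.mk _ (a i))
    (hmonic : (Ideal.Quotient.mk _ (a d) : SkewCode.ResidueRing L 𝔭) = 1)
    (hdvd : g ∣ SkewCode.centralPoly σ γ 𝔭) :
    𝔓.valuation L lam = 1 ∧
    (∃ h : SkewCode.SkewPoly (SkewCode.resAut σ 𝔭),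
      SkewCode.IsMonicOfDegree h (Module.finrank k L - d) ∧
      h * SkewCode.twistedReverse σ 𝔭 lam d a = SkewCode.centralPoly σ γ 𝔭 ∧
      SkewCode.twistedReverse σ 𝔭 lam d a * h = SkewCode.centralPoly σ γ 𝔭 ∧
      SkewCode.dualCode hwd (SkewCode.codeIdeal σ γ 𝔭 g) = SkewCode.codeIdeal σ γ 𝔭 h) ∧
    ((SkewCode.codeIdeal σ γ 𝔭 g : Set (SkewCode.CodeRing σ γ 𝔭)) ⊆
        SkewCode.dualCode hwd (SkewCode.codeIdeal σ γ 𝔭 g) ↔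
      SkewCode.centralPoly σ γ 𝔭 ∣ g * SkewCode.twistedReverse σ 𝔭 lam d a) ∧
    ((SkewCode.codeIdeal σ γ 𝔭 g : Set (SkewCode.CodeRing σ γ 𝔭)) =
        SkewCode.dualCode hwd (SkewCode.codeIdeal σ γ 𝔭 g) ↔
      g * SkewCode.twistedReverse σ 𝔭 lam d a = SkewCode.centralPoly σ γ 𝔭) := by
  change 𝔓.asIdeal = SkewCode.extIdeal L 𝔭 at hinert
  have hmax : (SkewCode.extIdeal L 𝔭).IsMaximal := hinert ▸ 𝔓.isMaximal
  have hγ0 : (γ : k) ≠ 0 := fun h0 => by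
    rw [NumberField.RingOfIntegers.coe_eq_zero_iff.1 h0, zero_mul] at hγ
    exact zero_ne_one hγ
  set c := SkewCode.resConj hL hconj
  have hc := SkewCode.resConj_mk hL hconj
  have hcσ := SkewCode.resConj_resAut hL hconj σ
  have hγc := SkewCode.residueGamma_mul_resConj hL hconj hγ
  have hn : 0 < Module.finrank k L := Module.finrank_pos
  have htw := SkewCode.twist_resAut_finrank σ 𝔭
  have hσγ := SkewCode.resAut_residueGamma σ γ 𝔭
  have hquot := SkewCode.exists_mk_mul_residueClass
    (SkewCode.exists_mul_eq_of_nondegenerate hwd htame hp 𝔓 hinert hγ0 hnd c hc)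
  have hval : 𝔓.valuation L lam = 1 := by
    obtain ⟨x, y, hx, hy, hxy, -⟩ := hquot
    rw [← hinert] at hx hy
    have h := congrArg (𝔓.valuation L) hxy
    rwa [map_mul, 𝔓.valuation_eq_one_iff_notMem.2 hx, 𝔓.valuation_eq_one_iff_notMem.2 hy,
      mul_one] at h
  have hlamu : IsUnit (SkewCode.residueClass 𝔭 lam) := by
    obtain ⟨x, y, hx, -, -, hxy⟩ := hquot
    exact isUnit_of_mul_isUnit_right (hxy ▸ SkewCode.isUnit_mk_of_notMem hx)
  set b : ℕ → SkewCode.ResidueRing L 𝔭 := fun i => Ideal.Quotient.mk _ (a i)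
  obtain ⟨h, hhm, hh, hh'⟩ := SkewCode.exists_monic_cofactor_reverse hcσ hn htw hσγ hγc hlamu
    (b := b) hmonic (hg ▸ hdvd) (g' := SkewCode.twistedReverse σ 𝔭 lam d a) rfl
  have hb0 : IsUnit (b 0) :=
    SkewCode.isUnit_of_dvd_cyclicPoly hn (IsUnit.of_mul_eq_one _ hγc) (hg ▸ hdvd)
  -- The normalising constant is an honest inverse: `[a₀]` is a unit because it divides `-[γ]`, so
  -- `Ring.inverse` does not take its default value `0`.
  have hκ : IsUnit (SkewCode.twist (SkewCode.resAut σ 𝔭) d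
      (Ring.inverse (SkewCode.residueClass 𝔭 lam * c (b 0)))) :=
    ((hlamu.mul (hb0.map c)).ringInverse).map _
  have hdual : SkewCode.dualCode hwd (SkewCode.codeIdeal σ γ 𝔭 g) =
      {y | y * SkewCode.rho σ γ 𝔭 (SkewCode.twistedReverse σ 𝔭 lam d a) = 0} := by
    have hrev : SkewCode.twistedReverse σ 𝔭 lam d a = _ :=
      SkewCode.ofCoeffs_reverse_eq c d b (SkewCode.residueClass 𝔭 lam) _
    rw [hrev, ← hg]
    exact SkewCode.dualCode_span_rho hwd hnd hγ0 hc hγc hcσ hlamu hquot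
      (hg ▸ SkewCode.degLE_ofCoeffs d b) hκ
  have hg'0 : SkewCode.twistedReverse σ 𝔭 lam d a ≠ 0 := by
    intro h0
    rw [h0, mul_zero] at hh
    exact SkewCode.cyclicPoly_ne_zero hn hh.symm
  have hsurj := SkewCode.rho_surjective σ γ 𝔭
  have hker := SkewCode.rho_eq_zero_iff σ γ 𝔭
  have hcomm := SkewCode.centralPoly_mul_comm σ γ 𝔭
  obtain ⟨q, hq⟩ := hdvd
  have hqg := SkewCode.mul_comm_of_mul_eq_cyclicPoly hn htw hσγ hq.symm
  refine ⟨hval, ⟨h, hhm, hh, hh', ?_⟩, ?_, ?_⟩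
  · rw [hdual]
    exact SkewCode.annihilator_eq_span hsurj hker hcomm hg'0 hh
  · rw [hdual]
    exact SkewCode.span_subset_annihilator_iff hker g _
  · rw [hdual]
    exact SkewCode.span_eq_annihilator_iff hsurj hker hcomm ⟨b, hmonic, hg⟩ hhm hg'0 hh hh' hqg
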